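/- There is an absolute constant $L>0$ such that for every $\varepsilon>0$ there exists $v_0>0$, depending only on $\varepsilon$, such that for every $v\ge v_0$ the following holds. Let $N\ge 1$, let $S=\{z\in\mathbb{R}^N:|z|=1\}$ be the Euclidean unit sphere, and let $Q$ be any probability distribution on the set of Borel probability measures on $S$. Then there exists a (non-random) measurable function $g:S\to\mathbb{R}$ such that $$\sup_{z\in S}|g(z)|\le L\,v\,\sqrt{N}\qquad\text{and}\qquad \int \nu_g^{\otimes 2}\bigl\{(z^1,z^2): z^1\cdot z^2\le-\varepsilon\bigr\}\,dQ(\nu)\le\varepsilon,$$ where, for a probability measure $\nu$ on $S$, $\nu_g$ denotes the probability measure on $S$ with density $\dfrac{d\nu_g}{d\nu}(z)=\dfrac{e^{g(z)}}{\int_S e^{g}\,d\nu}$. -/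

import Mathlib

open MeasureTheory

/-! The law of a random Hamiltonian can be chosen without reference to the measure that it perturbs.
If, for every reference measure, the disorder-averaged probability of an overlap below `-ε` is at
most `ε`, then one may average over `Q` as well, exchange the two averages and keep a single good
realization. What has to be proved is Talagrand's positivity principle, uniformly in the reference
measure.

The Hamiltonian is a sum over `p < P` of fields with covariance `(z¹·z²)^p`, with amplitudes drawn
from a grid in `[X, 2X]`. Each field is a sum of many tiny features with independent signs: nearly
Gaussian, yet on a finite probability space. The free energy has bounded variance
(`variance_freeEnergy_le`) and is convex in each amplitude, so for most amplitudes each field has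
small fluctuations relative to its amplitude (`sum_expect_gibbs_abs_sub_le`). Integration by parts
turns this into approximate Ghirlanda–Guerra identities for each power of the overlap
(`IsFeatureSystem.ghirlanda_guerra`), hence for polynomials (`GhirlandaGuerra.sum`).

Let `q` be the probability that two replicas have overlap below `-ε`. For a polynomial approximating
a step function, the identities show that requiring one more replica to be negatively correlated
with all the previous ones costs at most a factor of about `q` (`expect_allNeg_succ_ge`). So `m + 1`
replicas are pairwise negatively correlated with probability at least about `q ^ m`. Since `‖∑ z i‖
^ 2 ≥ 0` forbids this for large `m`, `q` is small (`pow_expect_neg_le`).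

The number of fields and their amplitudes depend on `ε` only, so `H(z)` is subgaussian with a
variance depending on `ε` only. Truncating it at a level `C(ε)` changes Gibbs averages little
(`expect_truncation_error_le`). The resulting bound does not grow with `N`, which is more than the
theorem asks. Quantizing the sphere reduces everything to finite sums. -/

namespace SpinGlass

open scoped BigOperators

/-- The average of `f` under the Gibbs measure with reference weights `w` and Hamiltonian `H`. -/
noncomputable def gibbs {S : Type*} [Fintype S] (w H f : S → ℝ) : ℝ :=
  (∑ a, w a * Real.exp (H a) * f a) / ∑ a, w a * Real.exp (H a)

/-- `w` is a vector of probability weights. -/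
structure IsWeight {S : Type*} [Fintype S] (w : S → ℝ) : Prop where
  nonneg : ∀ a, 0 ≤ w a
  sum_one : ∑ a, w a = 1

/-! ### Gibbs averages: convexity, variance and second-order expansion. -/

section Gibbs

variable {S : Type*} [Fintype S] {w : S → ℝ}

lemma partition_pos (hw : IsWeight w) (H : S → ℝ) : 0 < ∑ a, w a * Real.exp (H a) := by
  have h0 : ∀ a ∈ Finset.univ, 0 ≤ w a * Real.exp (H a) :=
    fun a _ => mul_nonneg (hw.nonneg a) (Real.exp_pos _).le
  refine lt_of_le_of_ne (Finset.sum_nonneg h0) fun h => ?_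
  have h1 := (Finset.sum_eq_zero_iff_of_nonneg h0).1 h.symm
  have h2 : ∑ a, w a = 0 := Finset.sum_eq_zero fun a ha =>
    (mul_eq_zero.1 (h1 a ha)).resolve_right (Real.exp_pos _).ne'
  rw [hw.sum_one] at h2
  exact one_ne_zero h2

lemma gibbs_const (hw : IsWeight w) (H : S → ℝ) (c : ℝ) : gibbs w H (fun _ => c) = c := by
  unfold gibbs
  rw [← Finset.sum_mul, mul_div_assoc, mul_comm, div_mul_cancel₀ _ (partition_pos hw H).ne']

lemma gibbs_add (H f g : S → ℝ) :
    gibbs w H (fun a => f a + g a) = gibbs w H f + gibbs w H g := by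
  unfold gibbs
  rw [← add_div, ← Finset.sum_add_distrib]
  simp only [mul_add]

lemma gibbs_const_mul (H f : S → ℝ) (c : ℝ) :
    gibbs w H (fun a => c * f a) = c * gibbs w H f := by
  unfold gibbs
  rw [← mul_div_assoc, Finset.mul_sum]
  congr 1
  exact Finset.sum_congr rfl fun a _ => by ring

lemma gibbs_mul_const (H f : S → ℝ) (c : ℝ) :
    gibbs w H (fun a => f a * c) = gibbs w H f * c := by
  rw [mul_comm, ← gibbs_const_mul]
  simp only [mul_comm]

lemma gibbs_sub (H f g : S → ℝ) :
    gibbs w H (fun a => f a - g a) = gibbs w H f - gibbs w H g := by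
  unfold gibbs
  rw [← sub_div, ← Finset.sum_sub_distrib]
  simp only [mul_sub]

lemma gibbs_sum {κ : Type*} (s : Finset κ) (H : S → ℝ) (f : κ → S → ℝ) :
    gibbs w H (fun a => ∑ k ∈ s, f k a) = ∑ k ∈ s, gibbs w H (f k) := by
  unfold gibbs
  rw [← Finset.sum_div, Finset.sum_comm]
  simp only [Finset.mul_sum]

lemma gibbs_mono (hw : IsWeight w) (H : S → ℝ) {f g : S → ℝ} (h : ∀ a, f a ≤ g a) :
    gibbs w H f ≤ gibbs w H g := by
  unfold gibbs
  refine div_le_div_of_nonneg_right (Finset.sum_le_sum fun a _ => ?_) (partition_pos hw H).le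
  exact mul_le_mul_of_nonneg_left (h a) (mul_nonneg (hw.nonneg a) (Real.exp_pos _).le)

lemma gibbs_nonneg (hw : IsWeight w) (H : S → ℝ) {f : S → ℝ} (h : ∀ a, 0 ≤ f a) :
    0 ≤ gibbs w H f :=
  (gibbs_const hw H 0).symm.le.trans (gibbs_mono hw H h)

lemma gibbs_le_of_le (hw : IsWeight w) (H : S → ℝ) {f : S → ℝ} {c : ℝ} (h : ∀ a, f a ≤ c) :
    gibbs w H f ≤ c :=
  (gibbs_mono hw H h).trans (gibbs_const hw H c).le

lemma abs_gibbs_le (hw : IsWeight w) (H f : S → ℝ) :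
    |gibbs w H f| ≤ gibbs w H (fun a => |f a|) := by
  rw [abs_le]
  constructor
  · have := gibbs_mono hw H (f := fun a => (-1) * |f a|) (g := f)
      fun a => by linarith [neg_abs_le (f a)]
    rw [gibbs_const_mul] at this
    linarith
  · exact gibbs_mono hw H fun a => le_abs_self _

lemma abs_gibbs_le_of_le (hw : IsWeight w) (H : S → ℝ) {f : S → ℝ} {c : ℝ}
    (h : ∀ a, |f a| ≤ c) : |gibbs w H f| ≤ c :=
  (abs_gibbs_le hw H f).trans (gibbs_le_of_le hw H h)

lemma gibbs_tilt (hw : IsWeight w) (H V f : S → ℝ) :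
    gibbs w (fun a => H a + V a) f
      = gibbs w H (fun a => Real.exp (V a) * f a) / gibbs w H (fun a => Real.exp (V a)) := by
  unfold gibbs
  rw [div_div_div_cancel_right₀ (partition_pos hw H).ne']
  simp only [Real.exp_add, mul_assoc]

lemma gibbs_exp_pos (hw : IsWeight w) (H V : S → ℝ) :
    0 < gibbs w H (fun a => Real.exp (V a)) := by
  have h := partition_pos hw (fun a => H a + V a)
  simp only [Real.exp_add, ← mul_assoc] at h
  exact div_pos h (partition_pos hw H)

/-- The square of a Gibbs average is at most the average of the square. -/
lemma gibbs_sq_le (hw : IsWeight w) (H f : S → ℝ) :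
    gibbs w H f ^ 2 ≤ gibbs w H (fun a => f a ^ 2) := by
  have h := gibbs_nonneg hw H (f := fun a => (f a - gibbs w H f) ^ 2) fun a => sq_nonneg _
  have e : (fun a => (f a - gibbs w H f) ^ 2)
      = fun a => (f a ^ 2 - 2 * gibbs w H f * f a) + gibbs w H f ^ 2 := by
    ext a; ring
  rw [e, gibbs_add, gibbs_sub, gibbs_const_mul, gibbs_const hw] at h
  nlinarith

/-- The free energy. -/
noncomputable def freeEnergy (w H : S → ℝ) : ℝ := Real.log (∑ a, w a * Real.exp (H a))

/-- Gibbs' variational inequality: the free energy is convex with gradient the Gibbs average. -/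
lemma gibbs_le_freeEnergy_sub (hw : IsWeight w) (H V : S → ℝ) :
    gibbs w H V ≤ freeEnergy w (fun a => H a + V a) - freeEnergy w H := by
  have hZ := partition_pos hw H
  have hZ' := partition_pos hw (fun a => H a + V a)
  set m := gibbs w H V with hm
  have h1 : Real.exp m ≤ gibbs w H (fun a => Real.exp (V a)) := by
    -- Jensen's inequality through the tangent line of `exp` at the mean `m`.
    have h2 : ∀ a, Real.exp m * (1 + (V a - m)) ≤ Real.exp (V a) := fun a => by
      have h3 := Real.add_one_le_exp (V a - m)
      have h4 : Real.exp (V a) = Real.exp m * Real.exp (V a - m) := by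
        rw [← Real.exp_add]; congr 1; ring
      rw [h4]
      exact mul_le_mul_of_nonneg_left (by linarith) (Real.exp_pos _).le
    have h5 := gibbs_mono hw H h2
    rw [gibbs_const_mul, gibbs_add, gibbs_sub, gibbs_const hw, gibbs_const hw, ← hm] at h5
    linarith
  have h6 : gibbs w H (fun a => Real.exp (V a))
      = (∑ a, w a * Real.exp (H a + V a)) / ∑ a, w a * Real.exp (H a) := by
    unfold gibbs
    simp only [Real.exp_add, mul_assoc]
  unfold freeEnergy
  rw [← Real.log_div hZ'.ne' hZ.ne', ← h6, Real.le_log_iff_exp_le (gibbs_exp_pos hw H V)]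
  exact h1

/-- Along a ray `H + u G` the Gibbs average of `G` grows at a rate controlled below by its
variance. -/
lemma variance_le_gibbs_sub (hw : IsWeight w) (H G : S → ℝ) {u B : ℝ} (hu : 0 ≤ u)
    (hB : ∀ a, |G a| ≤ B) (huB : u * B ≤ 1) :
    u * gibbs w H (fun a => (G a - gibbs w H G) ^ 2)
      ≤ Real.exp 2 * (gibbs w (fun a => H a + u * G a) G - gibbs w H G) := by
  set m := gibbs w H G with hm
  have hE := gibbs_exp_pos hw H (fun a => u * G a)
  set E := gibbs w H (fun a => Real.exp (u * G a)) with hEdef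
  have hEle : E ≤ Real.exp 1 := gibbs_le_of_le hw H fun a => Real.exp_le_exp.2 (by
    have := (abs_le.1 (hB a)).2
    nlinarith)
  -- Symmetrization over two replicas: since `|u G| ≤ 1`, the exponential has slope at least `exp
  -- (-1)` on the relevant range. Averaging over `a` and `b` turns the left side into the variance
  -- and the right side into the increment of the mean under the tilt.
  have hdouble : ∀ a b, u * Real.exp (-1) * (G a - G b) ^ 2
      ≤ (G a - G b) * (Real.exp (u * G a) - Real.exp (u * G b)) := by
    have key : ∀ a b, G b ≤ G a → u * Real.exp (-1) * (G a - G b)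
        ≤ Real.exp (u * G a) - Real.exp (u * G b) := fun a b hab => by
      have h1 := Real.add_one_le_exp (u * G a - u * G b)
      have h2 : Real.exp (u * G a) = Real.exp (u * G b) * Real.exp (u * G a - u * G b) := by
        rw [← Real.exp_add]; congr 1; ring
      have h3 : Real.exp (-1) ≤ Real.exp (u * G b) := Real.exp_le_exp.2 (by
        have := (abs_le.1 (hB b)).1
        nlinarith)
      have h4 : 0 ≤ u * (G a - G b) := mul_nonneg hu (by linarith)
      have h5 := mul_le_mul_of_nonneg_left h1 (Real.exp_pos (u * G b)).le
      have h6 := mul_le_mul_of_nonneg_right h3 h4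
      rw [h2]
      nlinarith
    intro a b
    rcases le_total (G b) (G a) with h | h
    · have := mul_le_mul_of_nonneg_right (key a b h) (sub_nonneg.2 h)
      nlinarith
    · have := mul_le_mul_of_nonneg_right (key b a h) (sub_nonneg.2 h)
      nlinarith
  have h1 := gibbs_mono hw H fun a => gibbs_mono hw H fun b => hdouble a b
  have e1 : gibbs w H (fun a => gibbs w H fun b => u * Real.exp (-1) * (G a - G b) ^ 2)
      = 2 * (u * Real.exp (-1)) * gibbs w H (fun a => (G a - m) ^ 2) := by
    have e : ∀ a b, (G a - G b) ^ 2
        = (G a - m) ^ 2 + (G b - m) ^ 2 - 2 * ((G a - m) * (G b - m)) := fun a b => by ring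
    have e0 : gibbs w H (fun a => G a - m) = 0 := by
      rw [gibbs_sub, gibbs_const hw, ← hm, sub_self]
    simp only [e, gibbs_const_mul, gibbs_add, gibbs_sub, gibbs_const hw, gibbs_mul_const, e0]
    ring
  have e2 : gibbs w H (fun a => gibbs w H fun b =>
      (G a - G b) * (Real.exp (u * G a) - Real.exp (u * G b)))
      = 2 * E * (gibbs w (fun a => H a + u * G a) G - m) := by
    have e : ∀ a b, (G a - G b) * (Real.exp (u * G a) - Real.exp (u * G b))
        = Real.exp (u * G a) * G a + Real.exp (u * G b) * G b
          - (G a * Real.exp (u * G b) + Real.exp (u * G a) * G b) := fun a b => by ring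
    rw [gibbs_tilt hw]
    simp only [e, gibbs_const_mul, gibbs_add, gibbs_sub, gibbs_const hw, gibbs_mul_const,
      ← hEdef, ← hm]
    field_simp
    ring
  rw [e1, e2] at h1
  have h7 : 0 ≤ gibbs w (fun a => H a + u * G a) G - m := by
    have h8 : 0 ≤ 2 * (u * Real.exp (-1)) * gibbs w H (fun a => (G a - m) ^ 2) :=
      mul_nonneg (by positivity) (gibbs_nonneg hw H fun a => sq_nonneg _)
    exact nonneg_of_mul_nonneg_right (h8.trans h1) (by positivity)
  have h9 : Real.exp 1 * Real.exp (-1) = 1 := by rw [← Real.exp_add]; simp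
  have h10 : Real.exp 2 = Real.exp 1 * Real.exp 1 := by rw [← Real.exp_add]; norm_num
  have h11 := mul_le_mul_of_nonneg_right hEle h7
  calc u * gibbs w H (fun a => (G a - m) ^ 2)
      = Real.exp 1 * (u * Real.exp (-1) * gibbs w H (fun a => (G a - m) ^ 2)) := by
        linear_combination (-u * gibbs w H (fun a => (G a - m) ^ 2)) * h9
    _ ≤ Real.exp 1 * (Real.exp 1 * (gibbs w (fun a => H a + u * G a) G - m)) :=
        mul_le_mul_of_nonneg_left (by linarith) (Real.exp_pos _).le
    _ = _ := by rw [h10]; ring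

lemma hasDerivAt_gibbs (hw : IsWeight w) (H V f : S → ℝ) (t : ℝ) :
    HasDerivAt (fun t => gibbs w (fun a => H a + t * V a) f)
      (gibbs w (fun a => H a + t * V a) (fun a => f a * V a)
        - gibbs w (fun a => H a + t * V a) f * gibbs w (fun a => H a + t * V a) V) t := by
  have hd : ∀ a, HasDerivAt (fun t => w a * Real.exp (H a + t * V a))
      (w a * (Real.exp (H a + t * V a) * V a)) t := fun a => by
    have h1 : HasDerivAt (fun t => H a + t * V a) (V a) t := by
      simpa using ((hasDerivAt_id t).mul_const (V a)).const_add (H a)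
    exact (h1.exp).const_mul (w a)
  have hN : HasDerivAt (fun t => ∑ a, w a * Real.exp (H a + t * V a) * f a)
      (∑ a, w a * (Real.exp (H a + t * V a) * V a) * f a) t :=
    HasDerivAt.fun_sum fun a _ => (hd a).mul_const (f a)
  have hZ : HasDerivAt (fun t => ∑ a, w a * Real.exp (H a + t * V a))
      (∑ a, w a * (Real.exp (H a + t * V a) * V a)) t :=
    HasDerivAt.fun_sum fun a _ => hd a
  have hp := partition_pos hw (fun a => H a + t * V a)
  refine (hN.div hZ hp.ne').congr_deriv ?_
  have e1 : ∑ a, w a * Real.exp (H a + t * V a) * (f a * V a)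
      = ∑ a, w a * (Real.exp (H a + t * V a) * V a) * f a :=
    Finset.sum_congr rfl fun a _ => by ring
  have e2 : ∑ a, w a * Real.exp (H a + t * V a) * V a
      = ∑ a, w a * (Real.exp (H a + t * V a) * V a) :=
    Finset.sum_congr rfl fun a _ => by ring
  unfold gibbs
  rw [e1, e2]
  field_simp

/-- The Gibbs covariance. -/
noncomputable def gibbsCov (w H f g : S → ℝ) : ℝ :=
  gibbs w H (fun a => f a * g a) - gibbs w H f * gibbs w H g

/-- Second order comparison between a symmetric difference quotient of a Gibbs average and its
derivative at the two end points. -/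
lemma abs_symm_diff_sub_gibbsCov_le (hw : IsWeight w) (H V f : S → ℝ) {c η : ℝ}
    (hf : ∀ a, |f a| ≤ c) (hV : ∀ a, |V a| ≤ η) :
    |(gibbs w (fun a => H a + V a) f - gibbs w (fun a => H a - V a) f) / 2
      - (gibbsCov w (fun a => H a + V a) f V + gibbsCov w (fun a => H a - V a) f V) / 2|
      ≤ 12 * c * η ^ 2 := by
  rcases isEmpty_or_nonempty S with hS | ⟨⟨a₀⟩⟩
  · have := hw.sum_one
    simp at this
  have hc : 0 ≤ c := (abs_nonneg _).trans (hf a₀)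
  have hη : 0 ≤ η := (abs_nonneg _).trans (hV a₀)
  set h : ℝ → ℝ := fun t => gibbs w (fun a => H a + t * V a) f with hh
  set h' : ℝ → ℝ := fun t => gibbsCov w (fun a => H a + t * V a) f V with hh'
  have d1 : ∀ t, HasDerivAt h (h' t) t := fun t => hasDerivAt_gibbs hw H V f t
  set h'' : ℝ → ℝ := fun t => gibbsCov w (fun a => H a + t * V a) (fun a => f a * V a) V
    - (gibbsCov w (fun a => H a + t * V a) f V * gibbs w (fun a => H a + t * V a) V
      + gibbs w (fun a => H a + t * V a) f * gibbsCov w (fun a => H a + t * V a) V V) with hh''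
  have d2 : ∀ t, HasDerivAt h' (h'' t) t := fun t =>
    (hasDerivAt_gibbs hw H V (fun a => f a * V a) t).sub
      ((hasDerivAt_gibbs hw H V f t).mul (hasDerivAt_gibbs hw H V V t))
  have hcov : ∀ (t : ℝ) (p q : S → ℝ) (x y : ℝ), (∀ a, |p a| ≤ x) → (∀ a, |q a| ≤ y) → 0 ≤ x →
      |gibbsCov w (fun a => H a + t * V a) p q| ≤ 2 * (x * y) := by
    intro t p q x y hp hq hx
    have h1 : |gibbs w (fun a => H a + t * V a) (fun a => p a * q a)| ≤ x * y :=
      abs_gibbs_le_of_le hw _ fun a => by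
        rw [abs_mul]; exact mul_le_mul (hp a) (hq a) (abs_nonneg _) hx
    have h2 : |gibbs w (fun a => H a + t * V a) p * gibbs w (fun a => H a + t * V a) q|
        ≤ x * y := by
      rw [abs_mul]
      exact mul_le_mul (abs_gibbs_le_of_le hw _ hp) (abs_gibbs_le_of_le hw _ hq) (abs_nonneg _) hx
    unfold gibbsCov
    exact (abs_sub _ _).trans (by linarith)
  -- The three terms of `h''` contribute `2 c η ^ 2` each.
  have hbd : ∀ t, |h'' t| ≤ 6 * c * η ^ 2 := by
    intro t
    have h1 := hcov t (fun a => f a * V a) V (c * η) η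
      (fun a => by rw [abs_mul]; exact mul_le_mul (hf a) (hV a) (abs_nonneg _) hc) hV
      (mul_nonneg hc hη)
    have h2 := mul_le_mul (hcov t f V c η hf hV hc)
      (abs_gibbs_le_of_le hw (fun a => H a + t * V a) hV) (abs_nonneg _) (by positivity)
    have h3 := mul_le_mul (abs_gibbs_le_of_le hw (fun a => H a + t * V a) hf)
      (hcov t V V η η hV hV hη) (abs_nonneg _) hc
    rw [← abs_mul] at h2 h3
    refine (abs_sub _ _).trans ?_
    have h4 := abs_add_le (gibbsCov w (fun a => H a + t * V a) f V
      * gibbs w (fun a => H a + t * V a) V)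
      (gibbs w (fun a => H a + t * V a) f * gibbsCov w (fun a => H a + t * V a) V V)
    nlinarith
  have lip : ∀ s t : ℝ, |h' t - h' s| ≤ 6 * c * η ^ 2 * |t - s| := fun s t => by
    have := Convex.norm_image_sub_le_of_norm_hasDerivWithin_le
      (f := h') (f' := h'') (s := Set.univ) (C := 6 * c * η ^ 2)
      (fun x _ => (d2 x).hasDerivWithinAt) (fun x _ => hbd x) convex_univ
      (Set.mem_univ s) (Set.mem_univ t)
    simpa using this
  -- The symmetric quotient is `h' ξ` for some `ξ` in `(-1, 1)`, at distance at most 2 from either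
  -- end point; with the Lipschitz constant `6 c η ^ 2` this gives the 12.
  obtain ⟨ξ, hξ, hmv⟩ := exists_hasDerivAt_eq_slope h h' (by norm_num : (-1 : ℝ) < 1)
    (fun x _ => (d1 x).continuousAt.continuousWithinAt) (fun x _ => d1 x)
  have e1 : h 1 = gibbs w (fun a => H a + V a) f := by simp [hh]
  have e2 : h (-1) = gibbs w (fun a => H a - V a) f := by simp [hh, sub_eq_add_neg]
  have e3 : h' 1 = gibbsCov w (fun a => H a + V a) f V := by simp [hh']
  have e4 : h' (-1) = gibbsCov w (fun a => H a - V a) f V := by simp [hh', sub_eq_add_neg]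
  rw [← e1, ← e2, ← e3, ← e4]
  have hmv' : (h 1 - h (-1)) / 2 = h' ξ := by rw [hmv]; norm_num
  rw [hmv']
  have l1 := lip 1 ξ
  have l2 := lip (-1) ξ
  have b1 : |ξ - 1| ≤ 2 := abs_le.2 ⟨by linarith [hξ.1], by linarith [hξ.2]⟩
  have b2 : |ξ - -1| ≤ 2 := abs_le.2 ⟨by linarith [hξ.1], by linarith [hξ.2]⟩
  have hk : 0 ≤ 6 * c * η ^ 2 := by positivity
  have l1' := l1.trans (mul_le_mul_of_nonneg_left b1 hk)
  have l2' := l2.trans (mul_le_mul_of_nonneg_left b2 hk)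
  rw [abs_le] at l1' l2' ⊢
  constructor <;> linarith [l1'.1, l1'.2, l2'.1, l2'.2]

end Gibbs

/-! ### Independent replicas. -/

section Replicas

variable {S : Type*} [Fintype S] {w : S → ℝ}

/-- The average of a function of `n` independent replicas. -/
noncomputable def rep (n : ℕ) (w H : S → ℝ) (f : (Fin n → S) → ℝ) : ℝ :=
  gibbs (fun z => ∏ l, w (z l)) (fun z => ∑ l, H (z l)) f

lemma sum_fin_succ (n : ℕ) (f : (Fin (n + 1) → S) → ℝ) :
    ∑ z, f z = ∑ z : Fin n → S, ∑ b : S, f (Fin.cons b z) := by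
  rw [← (Fin.consEquiv fun _ : Fin (n + 1) => S).sum_comp, Fintype.sum_prod_type_right]
  rfl

lemma IsWeight.prod (hw : IsWeight w) (n : ℕ) :
    IsWeight (fun z : Fin n → S => ∏ l, w (z l)) := by
  refine ⟨fun z => Finset.prod_nonneg fun l _ => hw.nonneg _, ?_⟩
  induction n with
  | zero => simp
  | succ n ih =>
    rw [sum_fin_succ]
    simp only [Fin.prod_univ_succ, Fin.cons_zero, Fin.cons_succ, ← Finset.sum_mul, hw.sum_one,
      one_mul, ih]

/-- Fubini, with the new replica at index 0; this is how a replica is added or integrated out later.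
-/
lemma rep_succ (n : ℕ) (H : S → ℝ) (f : (Fin (n + 1) → S) → ℝ) :
    rep (n + 1) w H f = rep n w H fun z => gibbs w H fun b => f (Fin.cons b z) := by
  unfold rep gibbs
  rw [sum_fin_succ, sum_fin_succ]
  simp only [Fin.prod_univ_succ, Fin.sum_univ_succ, Fin.cons_zero, Fin.cons_succ, Real.exp_add]
  have e1 : ∀ (z : Fin n → S) (b : S), w b * (∏ l, w (z l)) *
      (Real.exp (H b) * Real.exp (∑ l, H (z l)))
      = ((∏ l, w (z l)) * Real.exp (∑ l, H (z l))) * (w b * Real.exp (H b)) :=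
    fun z b => by ring
  simp only [e1, ← Finset.sum_mul_sum]
  rw [mul_comm (∑ z : Fin n → S, _), ← div_div]
  congr 1
  rw [Finset.sum_div]
  refine Finset.sum_congr rfl fun z _ => ?_
  rw [← mul_div_assoc, Finset.mul_sum]
  congr 1
  exact Finset.sum_congr rfl fun b _ => by ring

lemma rep_eval (hw : IsWeight w) (H u : S → ℝ) {n : ℕ} (l : Fin n) :
    rep n w H (fun z => u (z l)) = gibbs w H u := by
  induction n with
  | zero => exact l.elim0
  | succ n ih =>
    rw [rep_succ]
    refine Fin.cases ?_ (fun i => ?_) l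
    · simp only [Fin.cons_zero]
      exact gibbs_const (hw.prod n) _ _
    · simp only [Fin.cons_succ, gibbs_const hw]
      exact ih i

lemma rep_one (hw : IsWeight w) (H : S → ℝ) (f : (Fin 1 → S) → ℝ) :
    rep 1 w H f = gibbs w H fun b => f fun _ => b := by
  rw [← rep_eval hw H (fun b => f fun _ => b) (0 : Fin 1)]
  congr 1
  ext z
  congr 1
  ext i
  rw [Subsingleton.elim i 0]

end Replicas

/-! ### Random signs and the Poincaré inequality on the cube. -/

section Signs

variable {ι : Type*} [DecidableEq ι]

/-- The sign `±1` of a bit. -/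
noncomputable def sgn (b : Bool) : ℝ := if b then 1 else -1

@[simp] lemma sgn_true : sgn true = 1 := rfl
@[simp] lemma sgn_false : sgn false = -1 := by simp [sgn]
lemma abs_sgn (b : Bool) : |sgn b| = 1 := by cases b <;> simp
lemma sgn_sq (b : Bool) : sgn b ^ 2 = 1 := by cases b <;> simp

/-- Flip the bit at `i`. -/
def flip (i : ι) (r : ι → Bool) : ι → Bool := Function.update r i (!r i)

lemma flip_flip (i : ι) (r : ι → Bool) : flip i (flip i r) = r := by
  simp [flip]

lemma expect_flip [Fintype ι] (i : ι) (f : (ι → Bool) → ℝ) : 𝔼 r, f (flip i r) = 𝔼 r, f r :=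
  Fintype.expect_equiv (Function.Involutive.toPerm (flip i) (flip_flip i)) _ _ fun _ => rfl

lemma expect_update [Fintype ι] (i : ι) (f : (ι → Bool) → ℝ) :
    𝔼 r, f r = 𝔼 r, (f (Function.update r i true) + f (Function.update r i false)) / 2 := by
  have h : ∀ r, (f (Function.update r i true) + f (Function.update r i false)) / 2
      = (f r + f (flip i r)) / 2 := fun r => by
    unfold flip
    cases h : r i
    · rw [← h, Function.update_eq_self]; simp [h, add_comm]
    · rw [← h, Function.update_eq_self]; simp [h]
  simp only [h, ← Finset.expect_div, Finset.expect_add_distrib, expect_flip]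
  ring

end Signs

section Cube

lemma expect_fin_succ {n : ℕ} (f : (Fin (n + 1) → Bool) → ℝ) :
    𝔼 r, f r = 𝔼 r : Fin n → Bool, (f (Fin.cons true r) + f (Fin.cons false r)) / 2 := by
  rw [expect_update 0]
  rw [Fintype.expect_eq_sum_div_card, Fintype.expect_eq_sum_div_card,
    ← (Fin.consEquiv fun _ : Fin (n + 1) => Bool).sum_comp, Fintype.sum_prod_type]
  have key : ∀ (b c : Bool) (r : Fin n → Bool),
      Function.update ((Fin.consEquiv fun _ : Fin (n + 1) => Bool) (b, r)) 0 c = Fin.cons c r :=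
    fun b c r => Fin.update_cons_zero _ _ _
  simp only [key, Fintype.sum_bool, Fintype.card_pi,
    Finset.prod_const, Finset.card_univ, Fintype.card_fin, Fintype.card_bool]
  push_cast
  rw [pow_succ]
  field_simp
  ring

lemma flip_cons_zero {n : ℕ} (b : Bool) (r : Fin n → Bool) :
    flip 0 (Fin.cons b r : Fin (n + 1) → Bool) = Fin.cons (!b) r := by
  simp [flip]

lemma flip_cons_succ {n : ℕ} (b : Bool) (r : Fin n → Bool) (i : Fin n) :
    flip i.succ (Fin.cons b r : Fin (n + 1) → Bool) = Fin.cons b (flip i r) := by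
  simp [flip, Fin.cons_update]

/-- Induction on the dimension: the variance is that of the average `g` over the first bit plus the
mean conditional variance in that bit. Averaging over a bit can only decrease the flip energies in
the other directions. -/
lemma poincare_fin (n : ℕ) (f : (Fin n → Bool) → ℝ) :
    𝔼 r, f r ^ 2 - (𝔼 r, f r) ^ 2 ≤ (∑ i, 𝔼 r, (f r - f (flip i r)) ^ 2) / 4 := by
  induction n with
  | zero => simp
  | succ n ih =>
    set g : (Fin n → Bool) → ℝ := fun r => (f (Fin.cons true r) + f (Fin.cons false r)) / 2
      with hg
    have h1 := ih g
    have e1 : 𝔼 r, f r = 𝔼 r, g r := expect_fin_succ f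
    have e2 : 𝔼 r, f r ^ 2
        = 𝔼 r, g r ^ 2 + (𝔼 r, (f r - f (flip 0 r)) ^ 2) / 4 := by
      rw [expect_fin_succ, expect_fin_succ (fun r => (f r - f (flip 0 r)) ^ 2),
        Finset.expect_div, ← Finset.expect_add_distrib]
      refine Finset.expect_congr rfl fun r _ => ?_
      simp only [flip_cons_zero, hg, Bool.not_true, Bool.not_false]
      ring
    have e3 : ∀ i : Fin n, 𝔼 r, (g r - g (flip i r)) ^ 2
        ≤ 𝔼 r, (f r - f (flip i.succ r)) ^ 2 := fun i => by
      rw [expect_fin_succ]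
      refine Finset.expect_le_expect fun r _ => ?_
      simp only [flip_cons_succ, hg]
      nlinarith [sq_nonneg (f (Fin.cons true r) - f (Fin.cons true (flip i r))
        - (f (Fin.cons false r) - f (Fin.cons false (flip i r))))]
    rw [e1, e2, Fin.sum_univ_succ]
    have h2 := Finset.sum_le_sum fun i (_ : i ∈ Finset.univ) => e3 i
    linarith

/-- The Poincaré inequality on the discrete cube. -/
lemma poincare {ι : Type*} [Fintype ι] [DecidableEq ι] (f : (ι → Bool) → ℝ) :
    𝔼 r, f r ^ 2 - (𝔼 r, f r) ^ 2 ≤ (∑ i, 𝔼 r, (f r - f (flip i r)) ^ 2) / 4 := by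
  set e := Fintype.equivFin ι
  have key : ∀ h : (ι → Bool) → ℝ,
      𝔼 r, h r = 𝔼 r : Fin (Fintype.card ι) → Bool, h (r ∘ e) := fun h =>
    (Fintype.expect_equiv (e.symm.arrowCongr (Equiv.refl Bool)) _ _ fun r => rfl).symm
  have hfl : ∀ (i : ι) (r : Fin (Fintype.card ι) → Bool),
      flip i (r ∘ e) = flip (e i) r ∘ e := fun i r => by
    unfold flip
    rw [Function.update_comp_eq_of_injective r e.injective]
    rfl
  have h := poincare_fin _ fun r => f (r ∘ e)
  simp only [key, hfl]
  rwa [← e.sum_comp (fun j => 𝔼 r, (f (r ∘ e) - f (flip j r ∘ e)) ^ 2)] at h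

/-- The discrete form of integration by parts: half the difference across a bit plays the role of
the derivative. -/
lemma expect_sgn_mul {ι : Type*} [Fintype ι] [DecidableEq ι] (i : ι) (f : (ι → Bool) → ℝ) :
    𝔼 r, sgn (r i) * f r
      = 𝔼 r, (f (Function.update r i true) - f (Function.update r i false)) / 2 := by
  rw [expect_update i]
  refine Finset.expect_congr rfl fun r _ => ?_
  simp
  ring

end Cube

/-! ### Approximate Gaussian integration by parts. -/

section Hamiltonian

variable {S ι : Type*} [Fintype S] [Fintype ι] [DecidableEq ι] {w : S → ℝ}

/-- The random Hamiltonian with features `ψ`, amplitudes `x` and signs `r`. -/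
noncomputable def ham (ψ : ι → S → ℝ) (x : ι → ℝ) (r : ι → Bool) (a : S) : ℝ :=
  ∑ i, sgn (r i) * (x i * ψ i a)

/-- The covariance of the Hamiltonians with amplitudes `σ` and `x`. -/
noncomputable def kernel (ψ : ι → S → ℝ) (σ x : ι → ℝ) (a b : S) : ℝ :=
  ∑ i, σ i * x i * (ψ i a * ψ i b)

omit [Fintype S] in
lemma ham_update (ψ : ι → S → ℝ) (x : ι → ℝ) (r : ι → Bool) (i : ι) (b : Bool) (a : S) :
    ham ψ x (Function.update r i b) a
      = (ham ψ x r a - sgn (r i) * (x i * ψ i a)) + sgn b * (x i * ψ i a) := by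
  unfold ham
  rw [← Finset.add_sum_erase _ _ (Finset.mem_univ i),
    ← Finset.add_sum_erase (a := i) (f := fun i => sgn (r i) * (x i * ψ i a)) _
      (Finset.mem_univ i), Function.update_self]
  have : ∑ j ∈ Finset.univ.erase i, sgn (Function.update r i b j) * (x j * ψ j a)
      = ∑ j ∈ Finset.univ.erase i, sgn (r j) * (x j * ψ j a) :=
    Finset.sum_congr rfl fun j hj => by
      rw [Function.update_of_ne (Finset.ne_of_mem_erase hj)]
  rw [this]
  ring

/-- Approximate integration by parts in one sign. -/
lemma abs_expect_sgn_mul_rep_sub_le (hw : IsWeight w) {n : ℕ} {ψ : ι → S → ℝ} {x : ι → ℝ}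
    {δ X c : ℝ} (hψ : ∀ i a, |ψ i a| ≤ δ) (hx : ∀ i, |x i| ≤ X) (i : ι)
    {φ : (Fin n → S) → ℝ} (hφ : ∀ z, |φ z| ≤ c) :
    |𝔼 r, sgn (r i) * rep n w (ham ψ x r) φ
      - 𝔼 r, gibbsCov (fun z : Fin n → S => ∏ l, w (z l)) (fun z => ∑ l, ham ψ x r (z l)) φ
          (fun z => ∑ l, x i * ψ i (z l))|
      ≤ 12 * c * (n * (X * δ)) ^ 2 := by
  rw [expect_sgn_mul, expect_update i (fun r => gibbsCov _ _ _ _), ← Finset.expect_sub_distrib]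
  refine (Finset.abs_expect_le _ _).trans
    (Finset.expect_le Finset.univ_nonempty fun r _ => ?_)
  have hV : ∀ z : Fin n → S, |∑ l, x i * ψ i (z l)| ≤ n * (X * δ) := fun z => by
    refine (Finset.abs_sum_le_sum_abs _ _).trans ?_
    have : ∀ l ∈ Finset.univ, |x i * ψ i (z l)| ≤ X * δ := fun l _ => by
      rw [abs_mul]
      exact mul_le_mul (hx i) (hψ i _) (abs_nonneg _) ((abs_nonneg _).trans (hx i))
    simpa using Finset.sum_le_card_nsmul _ _ _ this
  -- The base point is the Hamiltonian without its `i`-th summand; the two values of the sign then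
  -- add or subtract the same perturbation.
  have h := abs_symm_diff_sub_gibbsCov_le (hw.prod n)
    (fun z => ∑ l, (ham ψ x r (z l) - sgn (r i) * (x i * ψ i (z l)))) _ φ hφ hV
  unfold rep
  have e1 : ∀ z : Fin n → S, ∑ l, ham ψ x (Function.update r i true) (z l)
      = ∑ l, (ham ψ x r (z l) - sgn (r i) * (x i * ψ i (z l))) + ∑ l, x i * ψ i (z l) :=
    fun z => by
      rw [← Finset.sum_add_distrib]
      exact Finset.sum_congr rfl fun l _ => by rw [ham_update, sgn_true, one_mul]
  have e2 : ∀ z : Fin n → S, ∑ l, ham ψ x (Function.update r i false) (z l)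
      = ∑ l, (ham ψ x r (z l) - sgn (r i) * (x i * ψ i (z l))) - ∑ l, x i * ψ i (z l) :=
    fun z => by
      rw [← Finset.sum_sub_distrib]
      exact Finset.sum_congr rfl fun l _ => by rw [ham_update, sgn_false]; ring
  simp only [e1, e2]
  exact h

/-- Approximate Gaussian integration by parts for the replica average. -/
lemma abs_expect_rep_mul_ham_sub_le (hw : IsWeight w) {n : ℕ} {ψ : ι → S → ℝ} {σ x : ι → ℝ}
    {δ X : ℝ} (hψ : ∀ i a, |ψ i a| ≤ δ) (hx : ∀ i, |x i| ≤ X) (hσ : ∀ i, |σ i| ≤ 1)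
    {f : (Fin n → S) → ℝ} (hf : ∀ z, |f z| ≤ 1) (l : Fin n) :
    |𝔼 r, rep n w (ham ψ x r) (fun z => f z * ham ψ σ r (z l))
      - 𝔼 r, (rep n w (ham ψ x r) (fun z => f z * ∑ l', kernel ψ σ x (z l) (z l'))
        - n * rep n w (ham ψ x r)
            (fun z => f z * gibbs w (ham ψ x r) (kernel ψ σ x (z l))))|
      ≤ Fintype.card ι * (12 * δ * (n * (X * δ)) ^ 2) := by
  have e1 : ∀ r, rep n w (ham ψ x r) (fun z => f z * ham ψ σ r (z l))
      = ∑ i, σ i * (sgn (r i) * rep n w (ham ψ x r) (fun z => f z * ψ i (z l))) := fun r => by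
    unfold rep
    simp only [← gibbs_const_mul, ← gibbs_sum]
    congr 1
    ext z
    unfold ham
    rw [Finset.mul_sum]
    exact Finset.sum_congr rfl fun i _ => by ring
  have e2 : ∀ r, rep n w (ham ψ x r) (fun z => f z * ∑ l', kernel ψ σ x (z l) (z l'))
        - n * rep n w (ham ψ x r)
            (fun z => f z * gibbs w (ham ψ x r) (kernel ψ σ x (z l)))
      = ∑ i, σ i * gibbsCov (fun z : Fin n → S => ∏ l, w (z l))
          (fun z => ∑ l, ham ψ x r (z l)) (fun z => f z * ψ i (z l))
          (fun z => ∑ l, x i * ψ i (z l)) := fun r => by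
    have e3 : ∀ i, gibbs (fun z : Fin n → S => ∏ l, w (z l))
        (fun z => ∑ l, ham ψ x r (z l)) (fun z => ∑ l, x i * ψ i (z l))
        = n * (x i * gibbs w (ham ψ x r) (ψ i)) := fun i => by
      rw [gibbs_sum]
      have : ∀ l' : Fin n, gibbs (fun z : Fin n → S => ∏ l, w (z l))
        (fun z => ∑ l, ham ψ x r (z l)) (fun z => x i * ψ i (z l'))
          = x i * gibbs w (ham ψ x r) (ψ i) := fun l' => by
        rw [gibbs_const_mul]
        exact congrArg _ (rep_eval hw (ham ψ x r) (ψ i) l')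
      simp only [this, Finset.sum_const, Finset.card_univ, Fintype.card_fin, nsmul_eq_mul]
    have e4 : ∀ z : Fin n → S, gibbs w (ham ψ x r) (kernel ψ σ x (z l))
        = ∑ i, σ i * x i * gibbs w (ham ψ x r) (ψ i) * ψ i (z l) := fun z => by
      have : kernel ψ σ x (z l) = fun b => ∑ i, (σ i * x i * ψ i (z l)) * ψ i b := by
        ext b
        exact Finset.sum_congr rfl fun i _ => by ring
      rw [this, gibbs_sum]
      simp only [gibbs_const_mul]
      exact Finset.sum_congr rfl fun i _ => by ring
    unfold gibbsCov rep
    simp only [e3, e4, mul_sub, Finset.sum_sub_distrib]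
    congr 1
    · simp only [← gibbs_const_mul, ← gibbs_sum]
      congr 1
      ext z
      unfold kernel
      rw [Finset.sum_comm, Finset.mul_sum]
      refine Finset.sum_congr rfl fun i _ => ?_
      rw [Finset.mul_sum, Finset.mul_sum, Finset.mul_sum]
      exact Finset.sum_congr rfl fun l' _ => by ring
    · have e5 : (fun z : Fin n → S =>
          f z * ∑ i, σ i * x i * gibbs w (ham ψ x r) (ψ i) * ψ i (z l))
          = fun z => ∑ i, (σ i * x i * gibbs w (ham ψ x r) (ψ i)) * (f z * ψ i (z l)) := by
        ext z
        rw [Finset.mul_sum]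
        exact Finset.sum_congr rfl fun i _ => by ring
      rw [e5, gibbs_sum, Finset.mul_sum]
      refine Finset.sum_congr rfl fun i _ => ?_
      rw [gibbs_const_mul]
      ring
  simp only [e1, e2, Finset.expect_sum_comm, ← Finset.mul_expect, ← Finset.sum_sub_distrib,
    ← mul_sub]
  refine (Finset.abs_sum_le_sum_abs _ _).trans ?_
  refine (Finset.sum_le_card_nsmul _ _ (12 * δ * (n * (X * δ)) ^ 2) fun i _ => ?_).trans
    (by simp)
  -- The test function carries the factor `ψ i`, hence has size `δ`, and each sign costs order `δ ^
  -- 3`. This will beat the number of features, which is of order `δ ^ (-2)`.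
  have h1 := abs_expect_sgn_mul_rep_sub_le hw (n := n) hψ hx i
    (φ := fun z => f z * ψ i (z l)) (c := δ) fun z => by
      rw [abs_mul]
      calc |f z| * |ψ i (z l)| ≤ 1 * δ :=
            mul_le_mul (hf z) (hψ i _) (abs_nonneg _) zero_le_one
        _ = δ := one_mul δ
  refine le_trans ?_ h1
  rw [abs_mul]
  exact mul_le_of_le_one_left (abs_nonneg _) (hσ i)

end Hamiltonian

/-! ### Variance of the free energy. -/

section Variance

variable {S ι : Type*} [Fintype S] [Fintype ι] [DecidableEq ι] {w : S → ℝ}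

/-- The variance of the free energy of a random Hamiltonian. -/
lemma variance_freeEnergy_le (hw : IsWeight w) {ψ : ι → S → ℝ} {x : ι → ℝ} {X D : ℝ}
    (hx : ∀ i, |x i| ≤ X) (hD : ∀ a, ∑ i, ψ i a ^ 2 ≤ D) :
    𝔼 r, freeEnergy w (ham ψ x r) ^ 2 - (𝔼 r, freeEnergy w (ham ψ x r)) ^ 2 ≤ 2 * X ^ 2 * D := by
  refine (poincare _).trans ?_
  set m : ι → (ι → Bool) → ℝ := fun i r => gibbs w (ham ψ x r) (ψ i) with hm
  have h1 : ∀ i r, (freeEnergy w (ham ψ x r) - freeEnergy w (ham ψ x (flip i r))) ^ 2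
      ≤ 4 * X ^ 2 * (m i r ^ 2 + m i (flip i r) ^ 2) := fun i r => by
    have e : ∀ r a, ham ψ x (flip i r) a
        = ham ψ x r a + (-2 * sgn (r i) * x i) * ψ i a := fun r a => by
      have := ham_update ψ x r i (!r i) a
      unfold flip
      rw [this]
      cases r i <;> simp <;> ring
    have g1 := gibbs_le_freeEnergy_sub hw (ham ψ x r)
      (fun a => (-2 * sgn (r i) * x i) * ψ i a)
    have g2 := gibbs_le_freeEnergy_sub hw (ham ψ x (flip i r))
      (fun a => (-2 * sgn (flip i r i) * x i) * ψ i a)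
    simp only [← e, flip_flip] at g1 g2
    rw [gibbs_const_mul] at g1 g2
    set d := freeEnergy w (ham ψ x r) - freeEnergy w (ham ψ x (flip i r))
    have e1 : (-2 * sgn (r i) * x i * m i r) ^ 2 ≤ 4 * X ^ 2 * m i r ^ 2 := by
      have : x i ^ 2 ≤ X ^ 2 := sq_le_sq.2 ((hx i).trans (le_abs_self X))
      calc (-2 * sgn (r i) * x i * m i r) ^ 2 = 4 * (sgn (r i) ^ 2 * x i ^ 2 * m i r ^ 2) := by
            ring
        _ = 4 * (x i ^ 2 * m i r ^ 2) := by rw [sgn_sq, one_mul]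
        _ ≤ 4 * (X ^ 2 * m i r ^ 2) := by gcongr
        _ = _ := by ring
    have e2 : (-2 * sgn (flip i r i) * x i * m i (flip i r)) ^ 2
        ≤ 4 * X ^ 2 * m i (flip i r) ^ 2 := by
      have : x i ^ 2 ≤ X ^ 2 := sq_le_sq.2 ((hx i).trans (le_abs_self X))
      calc (-2 * sgn (flip i r i) * x i * m i (flip i r)) ^ 2
          = 4 * (sgn (flip i r i) ^ 2 * x i ^ 2 * m i (flip i r) ^ 2) := by ring
        _ = 4 * (x i ^ 2 * m i (flip i r) ^ 2) := by rw [sgn_sq, one_mul]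
        _ ≤ 4 * (X ^ 2 * m i (flip i r) ^ 2) := by gcongr
        _ = _ := by ring
    have g1' : -2 * sgn (r i) * x i * m i r ≤ -d := by simp only [d, hm]; linarith
    have g2' : -2 * sgn (flip i r i) * x i * m i (flip i r) ≤ d := g2
    -- Convexity bounds `d` above by a gradient term at `r` and below by one at `flip i r`; the sign
    -- of `d` decides which square dominates.
    have : d ^ 2 ≤ (-2 * sgn (r i) * x i * m i r) ^ 2
        + (-2 * sgn (flip i r i) * x i * m i (flip i r)) ^ 2 := by
      rcases le_total 0 d with h | h
      · nlinarith [sq_nonneg (-2 * sgn (flip i r i) * x i * m i (flip i r))]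
      · nlinarith [sq_nonneg (-2 * sgn (r i) * x i * m i r)]
    linarith
  have h2 : ∀ i, 𝔼 r, (freeEnergy w (ham ψ x r) - freeEnergy w (ham ψ x (flip i r))) ^ 2
      ≤ 8 * X ^ 2 * 𝔼 r, m i r ^ 2 := fun i => by
    refine (Finset.expect_le_expect fun r _ => h1 i r).trans ?_
    rw [← Finset.mul_expect, Finset.expect_add_distrib, expect_flip i (fun r => m i r ^ 2)]
    linarith
  -- Jensen brings the squares inside the Gibbs average, so the bound involves the variance of the
  -- field at a point and not the number of signs.
  have h3 : ∑ i, 𝔼 r, m i r ^ 2 ≤ D := by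
    rw [← Finset.expect_sum_comm]
    refine Finset.expect_le Finset.univ_nonempty fun r _ => ?_
    calc ∑ i, m i r ^ 2 ≤ ∑ i, gibbs w (ham ψ x r) (fun a => ψ i a ^ 2) :=
          Finset.sum_le_sum fun i _ => gibbs_sq_le hw _ _
      _ = gibbs w (ham ψ x r) (fun a => ∑ i, ψ i a ^ 2) := (gibbs_sum _ _ _).symm
      _ ≤ D := gibbs_le_of_le hw _ hD
  have h4 := Finset.sum_le_sum fun i (_ : i ∈ Finset.univ) => h2 i
  rw [← Finset.mul_sum] at h4
  have h5 := mul_le_mul_of_nonneg_left h3 (by positivity : 0 ≤ 8 * X ^ 2)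
  linarith

lemma expect_abs_sub_le {Ω : Type*} [Fintype Ω] [Nonempty Ω] (f : Ω → ℝ) {V : ℝ} (hV : 0 < V)
    (h : 𝔼 r, f r ^ 2 - (𝔼 r, f r) ^ 2 ≤ V ^ 2) : 𝔼 r, |f r - 𝔼 s, f s| ≤ V := by
  set m := 𝔼 s, f s with hm
  have h1 : ∀ r, |f r - m| ≤ ((f r - m) ^ 2 / V + V) / 2 := fun r => by
    have : |f r - m| * V ≤ ((f r - m) ^ 2 + V ^ 2) / 2 := by
      nlinarith [sq_nonneg (|f r - m| - V), sq_abs (f r - m)]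
    rw [← le_div_iff₀ hV] at this
    refine this.trans (le_of_eq ?_)
    field_simp
  have h2 : 𝔼 r, (f r - m) ^ 2 ≤ V ^ 2 := by
    have : ∀ r, (f r - m) ^ 2 = (f r ^ 2 - 2 * m * f r) + m ^ 2 := fun r => by ring
    simp only [this, Finset.expect_add_distrib, Finset.expect_sub_distrib, ← Finset.mul_expect,
      Fintype.expect_const, ← hm]
    linarith
  refine (Finset.expect_le_expect fun r _ => h1 r).trans ?_
  rw [← Finset.expect_div, Finset.expect_add_distrib, ← Finset.expect_div, Fintype.expect_const]
  have : (𝔼 r, (f r - m) ^ 2) / V ≤ V := by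
    rw [div_le_iff₀ hV]; nlinarith
  linarith

end Variance

/-! ### Concentration of a field from convexity of the free energy. -/

section Concentration

lemma sum_shift_sub (a : ℕ → ℝ) (K q : ℕ) :
    ∑ j ∈ Finset.range K, (a (j + q) - a j)
      = ∑ j ∈ Finset.range q, (a (K + j) - a j) := by
  rw [Finset.sum_sub_distrib, Finset.sum_sub_distrib]
  have h1 := Finset.sum_range_add a K q
  have h2 := Finset.sum_range_add a q K
  rw [add_comm q K] at h2
  simp only [add_comm q] at h2
  linarith

variable {S Ω : Type*} [Fintype S] [Fintype Ω] [Nonempty Ω] {w : S → ℝ}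

/-- If the free energy of `W + t G` concentrates and the mean of `G` is bounded, then `G` is
concentrated under the Gibbs measure and the disorder, for most `t`. -/
lemma sum_expect_gibbs_abs_sub_le (hw : IsWeight w) (W G : Ω → S → ℝ) {u B t₀ V c : ℝ} {K q : ℕ}
    (hu : 0 < u) (hq : 0 < q) (hB : ∀ r a, |G r a| ≤ B) (huB : u * B ≤ 1)
    (hV : ∀ t, t₀ - q * u ≤ t → t ≤ t₀ + K * u + q * u →
      𝔼 r, |freeEnergy w (fun a => W r a + t * G r a)
        - 𝔼 s, freeEnergy w (fun a => W s a + t * G s a)| ≤ V)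
    (hc : ∀ t, t₀ - q * u ≤ t → t ≤ t₀ + K * u + q * u →
      |𝔼 r, gibbs w (fun a => W r a + t * G r a) (G r)| ≤ c) :
    ∑ j ∈ Finset.range K, 𝔼 r, gibbs w (fun a => W r a + (t₀ + j * u) * G r a) (fun a =>
        |G r a - 𝔼 s, gibbs w (fun a => W s a + (t₀ + j * u) * G s a) (G s)|)
      ≤ K / 2 + Real.exp 2 * c / u + 4 * q * c + 3 * K * V / (q * u) := by
  set A : Ω → ℝ → ℝ := fun r t => gibbs w (fun a => W r a + t * G r a) (G r) with hA
  set F : Ω → ℝ → ℝ := fun r t => freeEnergy w (fun a => W r a + t * G r a) with hF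
  set mA : ℝ → ℝ := fun t => 𝔼 r, A r t with hmA
  set mF : ℝ → ℝ := fun t => 𝔼 r, F r t with hmF
  -- Two scales: the short step `u` controls the thermal variance, while the longer step `h` is used
  -- for difference quotients of the free energy, whose fluctuation enters divided by `h`.
  set h : ℝ := q * u with hh
  have hh0 : 0 < h := by positivity
  -- convexity
  have lower : ∀ r t s, s * A r t ≤ F r (t + s) - F r t := fun r t s => by
    have := gibbs_le_freeEnergy_sub hw (fun a => W r a + t * G r a) (fun a => s * G r a)
    rw [gibbs_const_mul] at this
    have e : (fun a => W r a + t * G r a + s * G r a) = fun a => W r a + (t + s) * G r a := by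
      ext a; ring
    rwa [e] at this
  have mlower : ∀ t s, s * mA t ≤ mF (t + s) - mF t := fun t s => by
    simp only [hmA, hmF, Finset.mul_expect, ← Finset.expect_sub_distrib]
    exact Finset.expect_le_expect fun r _ => lower r t s
  set Δ : Ω → ℝ → ℝ := fun r t => |F r t - mF t| with hΔ
  -- By convexity the derivative `A r t` lies between backward and forward difference quotients of
  -- `F r`. These are compared with those of the mean `mF`, which lie between `mA (t - h)` and `mA
  -- (t + h)`.
  have disorder : ∀ r t, |A r t - mA t| ≤ (mA (t + h) - mA (t - h))
      + (Δ r (t + h) + Δ r t + Δ r (t - h)) / h := fun r t => by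
    have a1 := lower r t h
    have a2 := lower r t (-h)
    have b1 := mlower (t + h) (-h)
    have b2 := mlower (t - h) h
    have b3 := mlower t h
    have b4 := mlower t (-h)
    rw [add_neg_cancel_right] at b1
    rw [sub_add_cancel] at b2
    rw [← sub_eq_add_neg] at a2 b4
    have d1 := abs_le.1 (le_refl |F r (t + h) - mF (t + h)|)
    have d2 := abs_le.1 (le_refl |F r t - mF t|)
    have d3 := abs_le.1 (le_refl |F r (t - h) - mF (t - h)|)
    have n1 : 0 ≤ |F r (t + h) - mF (t + h)| := abs_nonneg _
    have n3 : 0 ≤ |F r (t - h) - mF (t - h)| := abs_nonneg _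
    have key : |A r t - mA t| * h ≤ (mA (t + h) - mA (t - h)) * h
        + (Δ r (t + h) + Δ r t + Δ r (t - h)) := by
      rw [← abs_of_pos hh0, ← abs_mul, abs_of_pos hh0, abs_le]
      simp only [hΔ]
      constructor <;> nlinarith [d1.1, d1.2, d2.1, d2.2, d3.1, d3.2]
    rw [← le_div_iff₀ hh0] at key
    refine key.trans (le_of_eq ?_)
    field_simp
  -- thermal fluctuations
  have thermal : ∀ r t, gibbs w (fun a => W r a + t * G r a) (fun a => |G r a - A r t|)
      ≤ 1 / 2 + Real.exp 2 / (2 * u) * (A r (t + u) - A r t) := fun r t => by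
    have v := variance_le_gibbs_sub hw (fun a => W r a + t * G r a) (G r) hu.le (hB r) huB
    have e : (fun a => W r a + t * G r a + u * G r a) = fun a => W r a + (t + u) * G r a := by
      ext a; ring
    rw [e] at v
    change u * gibbs w _ (fun a => (G r a - A r t) ^ 2)
      ≤ Real.exp 2 * (A r (t + u) - A r t) at v
    -- From `|y| ≤ (1 + y ^ 2) / 2`. The constant `1 / 2` does not become small, but the fluctuation
    -- will be divided by a large amplitude.
    have v1 : gibbs w (fun a => W r a + t * G r a) (fun a => |G r a - A r t|)
        ≤ gibbs w (fun a => W r a + t * G r a) (fun a => 1 / 2 + 1 / 2 * (G r a - A r t) ^ 2) :=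
      gibbs_mono hw _ fun a => by
        nlinarith [sq_nonneg (|G r a - A r t| - 1), sq_abs (G r a - A r t)]
    rw [gibbs_add, gibbs_const hw, gibbs_const_mul] at v1
    have v2 : gibbs w (fun a => W r a + t * G r a) (fun a => (G r a - A r t) ^ 2)
        ≤ Real.exp 2 * (A r (t + u) - A r t) / u := by
      rw [le_div_iff₀ hu]; linarith
    have v3 : Real.exp 2 / (2 * u) * (A r (t + u) - A r t)
        = 1 / 2 * (Real.exp 2 * (A r (t + u) - A r t) / u) := by field_simp
    rw [v3]
    linarith
  have pointwise : ∀ t, t₀ ≤ t → t ≤ t₀ + K * u →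
      𝔼 r, gibbs w (fun a => W r a + t * G r a) (fun a => |G r a - mA t|)
      ≤ 1 / 2 + Real.exp 2 / (2 * u) * (mA (t + u) - mA t) + (mA (t + h) - mA (t - h))
        + 3 * V / h := fun t ht1 ht2 => by
    have p1 : ∀ r, gibbs w (fun a => W r a + t * G r a) (fun a => |G r a - mA t|)
        ≤ (1 / 2 + Real.exp 2 / (2 * u) * (A r (t + u) - A r t))
          + ((mA (t + h) - mA (t - h)) + (Δ r (t + h) + Δ r t + Δ r (t - h)) / h) := fun r => by
      have : gibbs w (fun a => W r a + t * G r a) (fun a => |G r a - mA t|)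
          ≤ gibbs w (fun a => W r a + t * G r a) (fun a => |G r a - A r t| + |A r t - mA t|) :=
        gibbs_mono hw _ fun a => abs_sub_le _ _ _
      rw [gibbs_add, gibbs_const hw] at this
      linarith [thermal r t, disorder r t]
    refine (Finset.expect_le_expect fun r _ => p1 r).trans ?_
    simp only [Finset.expect_add_distrib, Fintype.expect_const, ← Finset.mul_expect,
      Finset.expect_sub_distrib, ← Finset.expect_div]
    have q1 : 𝔼 r, Δ r (t + h) ≤ V := hV (t + h) (by linarith) (by linarith)
    have q2 : 𝔼 r, Δ r t ≤ V := hV t (by linarith) (by linarith)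
    have q3 : 𝔼 r, Δ r (t - h) ≤ V := hV (t - h) (by linarith) (by linarith)
    have q4 : (𝔼 r, Δ r (t + h) + 𝔼 r, Δ r t + 𝔼 r, Δ r (t - h)) / h ≤ 3 * V / h :=
      div_le_div_of_nonneg_right (by linarith) hh0.le
    change 1 / 2 + Real.exp 2 / (2 * u) * (mA (t + u) - mA t) + (mA (t + h) - mA (t - h)
      + _) ≤ _
    linarith
  have hKu : 0 ≤ K * u := by positivity
  have bound : ∀ t s, t₀ - h ≤ t → t ≤ t₀ + K * u + h → t₀ - h ≤ s → s ≤ t₀ + K * u + h →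
      mA t - mA s ≤ 2 * c := fun t s h1 h2 h3 h4 => by
    have b1 : mA t ≤ c := (abs_le.1 (hc t h1 h2)).2
    have b2 : -c ≤ mA s := (abs_le.1 (hc s h3 h4)).1
    linarith
  have s1 : ∑ j ∈ Finset.range K, (mA (t₀ + j * u + u) - mA (t₀ + j * u)) ≤ 2 * c := by
    have e : ∀ j : ℕ, mA (t₀ + j * u + u) - mA (t₀ + j * u)
        = mA (t₀ + (j + 1 : ℕ) * u) - mA (t₀ + j * u) := fun j => by
      push_cast
      congr 2
      ring
    simp only [e]
    rw [Finset.sum_range_sub (fun j : ℕ => mA (t₀ + j * u))]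
    refine bound _ _ (by linarith) (by linarith) ?_ ?_ <;> push_cast <;> linarith
  -- The shift by `2 h` is `2 q` grid steps, so after telescoping `2 q` differences remain, each at
  -- most `2 c`.
  have s2 : ∑ j ∈ Finset.range K, (mA (t₀ + j * u + h) - mA (t₀ + j * u - h))
      ≤ 2 * q * (2 * c) := by
    have e : ∀ j : ℕ, mA (t₀ + j * u + h) - mA (t₀ + j * u - h)
        = mA (t₀ - h + (j + 2 * q : ℕ) * u) - mA (t₀ - h + j * u) := fun j => by
      push_cast
      congr 2
      · rw [hh]; ring
      · ring
    simp only [e]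
    rw [sum_shift_sub (fun j : ℕ => mA (t₀ - h + j * u))]
    refine (Finset.sum_le_card_nsmul _ _ (2 * c) fun j hj => ?_).trans (by simp)
    have hj' : (j : ℝ) ≤ 2 * q := by
      have := (Finset.mem_range.1 hj).le
      exact_mod_cast this
    have hju : (j : ℝ) * u ≤ 2 * q * u := mul_le_mul_of_nonneg_right hj' hu.le
    have hju0 : 0 ≤ (j : ℝ) * u := by positivity
    refine bound _ _ ?_ ?_ ?_ ?_ <;> push_cast <;> rw [hh] <;> nlinarith
  refine (Finset.sum_le_sum fun (j : ℕ) (hj : j ∈ Finset.range K) =>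
    pointwise (t₀ + j * u) ?_ ?_).trans ?_
  · have : 0 ≤ (j : ℝ) * u := by positivity
    linarith
  · have : (j : ℝ) ≤ K := by exact_mod_cast (Finset.mem_range.1 hj).le
    have := mul_le_mul_of_nonneg_right this hu.le
    linarith
  · simp only [Finset.sum_add_distrib, ← Finset.mul_sum, Finset.sum_const, Finset.card_range,
      nsmul_eq_mul]
    have t1 := mul_le_mul_of_nonneg_left s1 (by positivity : 0 ≤ Real.exp 2 / (2 * u))
    have e1 : Real.exp 2 / (2 * u) * (2 * c) = Real.exp 2 * c / u := by field_simp
    have e2 : (K : ℝ) * (3 * V / h) = 3 * K * V / h := by ring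
    rw [e2]
    linarith

end Concentration

/-! ### Ghirlanda–Guerra identities for a single kernel. -/

section Features

variable {S ι : Type*} [Fintype S] [Fintype ι] [DecidableEq ι] {w : S → ℝ} {P : ℕ}

/-- Features `ψ` of size at most `δ`, sorted into `P` groups; the features of group `p` span the
covariance `K p`, which is bounded by one and equal to one on the diagonal. -/
structure IsFeatureSystem (ψ : ι → S → ℝ) (τ : ι → Fin P) (K : Fin P → S → S → ℝ) (δ : ℝ) :
    Prop where
  small : ∀ i a, |ψ i a| ≤ δ
  cov : ∀ p a b, ∑ i, (if τ i = p then ψ i a * ψ i b else 0) = K p a b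
  diag : ∀ p a, K p a a = 1
  abs_le_one : ∀ p a b, |K p a b| ≤ 1

/-- The indicator of the features of group `p`. -/
noncomputable def groupInd (τ : ι → Fin P) (p : Fin P) (i : ι) : ℝ := if τ i = p then 1 else 0

omit [Fintype ι] [DecidableEq ι] in
lemma abs_groupInd_le (τ : ι → Fin P) (p : Fin P) (i : ι) : |groupInd τ p i| ≤ 1 := by
  unfold groupInd
  split_ifs <;> simp

/-- The fluctuation, thermal and disordered, of the part of the Hamiltonian in group `p`. -/
noncomputable def fluct (w : S → ℝ) (ψ : ι → S → ℝ) (τ : ι → Fin P) (p : Fin P)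
    (x : Fin P → ℝ) : ℝ :=
  𝔼 r, gibbs w (ham ψ (fun i => x (τ i)) r) fun a => |ham ψ (groupInd τ p) r a
    - 𝔼 s, gibbs w (ham ψ (fun i => x (τ i)) s) (ham ψ (groupInd τ p) s)|

/-- The error in the approximate integration by parts with `n` replicas. -/
noncomputable def ibpError (ι : Type*) [Fintype ι] (δ X : ℝ) (n : ℕ) : ℝ :=
  Fintype.card ι * (12 * δ * (n * (X * δ)) ^ 2)

variable {ψ : ι → S → ℝ} {τ : ι → Fin P} {K : Fin P → S → S → ℝ} {δ : ℝ}

omit [Fintype S] [DecidableEq ι] in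
lemma IsFeatureSystem.kernel_eq (h : IsFeatureSystem ψ τ K δ) (p : Fin P) (x : Fin P → ℝ)
    (a b : S) : kernel ψ (groupInd τ p) (fun i => x (τ i)) a b = x p * K p a b := by
  unfold kernel groupInd
  rw [← h.cov, Finset.mul_sum]
  refine Finset.sum_congr rfl fun i _ => ?_
  split_ifs with hi
  · simp only [hi]; ring
  · ring

omit [Fintype S] [DecidableEq ι] in
lemma IsFeatureSystem.sum_sq (h : IsFeatureSystem ψ τ K δ) (a : S) :
    ∑ i, ψ i a ^ 2 = P := by
  have h1 : ∑ p : Fin P, ∑ i, (if τ i = p then ψ i a * ψ i a else 0) = P := by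
    simp [h.cov, h.diag]
  rw [← h1, Finset.sum_comm]
  refine Finset.sum_congr rfl fun i _ => ?_
  simp [pow_two]

/-- Approximate integration by parts for the part of the Hamiltonian in group `p`. -/
lemma IsFeatureSystem.abs_ibp_le (h : IsFeatureSystem ψ τ K δ) (hw : IsWeight w) {n : ℕ}
    {x : Fin P → ℝ} {X : ℝ} (hx : ∀ p, |x p| ≤ X) (p : Fin P) {f : (Fin n → S) → ℝ}
    (hf : ∀ z, |f z| ≤ 1) (l : Fin n) :
    |𝔼 r, rep n w (ham ψ (fun i => x (τ i)) r) (fun z => f z * ham ψ (groupInd τ p) r (z l))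
      - x p * 𝔼 r, (rep n w (ham ψ (fun i => x (τ i)) r)
          (fun z => f z * ∑ l', K p (z l) (z l'))
        - n * rep n w (ham ψ (fun i => x (τ i)) r)
            (fun z => f z * gibbs w (ham ψ (fun i => x (τ i)) r) (K p (z l))))|
      ≤ ibpError ι δ X n := by
  have h1 := abs_expect_rep_mul_ham_sub_le hw h.small (x := fun i => x (τ i))
    (fun i => hx (τ i)) (abs_groupInd_le τ p) hf l
  have e1 : ∀ a, kernel ψ (groupInd τ p) (fun i => x (τ i)) a = fun b => x p * K p a b :=
    fun a => funext fun b => h.kernel_eq p x a b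
  simp only [e1, gibbs_const_mul, ← Finset.mul_sum] at h1
  have e2 : ∀ (r : ι → Bool) (g : (Fin n → S) → ℝ),
      rep n w (ham ψ (fun i => x (τ i)) r) (fun z => f z * (x p * g z))
        = x p * rep n w (ham ψ (fun i => x (τ i)) r) (fun z => f z * g z) := fun r g => by
    unfold rep
    rw [← gibbs_const_mul]
    congr 1
    ext z
    ring
  simp only [e2] at h1
  rw [Finset.mul_expect]
  refine le_trans (le_of_eq ?_) h1
  congr 2
  refine Finset.expect_congr rfl fun r _ => ?_
  ring

/-- The mean of the part of the Hamiltonian in group `p`. -/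
lemma IsFeatureSystem.abs_mean_sub_le (h : IsFeatureSystem ψ τ K δ) (hw : IsWeight w)
    {x : Fin P → ℝ} {X : ℝ} (hx : ∀ p, |x p| ≤ X) (p : Fin P) :
    |𝔼 r, gibbs w (ham ψ (fun i => x (τ i)) r) (ham ψ (groupInd τ p) r)
      - x p * (1 - 𝔼 r, gibbs w (ham ψ (fun i => x (τ i)) r)
          (fun a => gibbs w (ham ψ (fun i => x (τ i)) r) (K p a)))|
      ≤ ibpError ι δ X 1 := by
  have h1 := h.abs_ibp_le hw hx p (n := 1) (f := fun _ => 1) (fun _ => by simp) 0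
  simp only [rep_one hw, one_mul, Fin.sum_univ_one, h.diag, gibbs_const hw, Nat.cast_one,
    Finset.expect_sub_distrib, Fintype.expect_const] at h1
  exact h1

/-- The approximate Ghirlanda–Guerra identity for one kernel. -/
lemma IsFeatureSystem.ghirlanda_guerra (h : IsFeatureSystem ψ τ K δ) (hw : IsWeight w) {n : ℕ}
    {x : Fin P → ℝ} {X : ℝ} (hx : ∀ p, |x p| ≤ X) (p : Fin P) (hp : 0 < x p)
    {f : (Fin n → S) → ℝ} (hf : ∀ z, |f z| ≤ 1) (l : Fin n) :
    |n * 𝔼 r, rep n w (ham ψ (fun i => x (τ i)) r)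
            (fun z => f z * gibbs w (ham ψ (fun i => x (τ i)) r) (K p (z l)))
        - 𝔼 r, rep n w (ham ψ (fun i => x (τ i)) r)
            (fun z => f z * ∑ l' ∈ Finset.univ.erase l, K p (z l) (z l'))
        - (𝔼 r, rep n w (ham ψ (fun i => x (τ i)) r) f)
          * 𝔼 r, gibbs w (ham ψ (fun i => x (τ i)) r)
            (fun a => gibbs w (ham ψ (fun i => x (τ i)) r) (K p a))|
      ≤ (fluct w ψ τ p x + ibpError ι δ X n + ibpError ι δ X 1) / x p := by
  have h1 := h.abs_ibp_le hw hx p hf l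
  have h2 := h.abs_mean_sub_le hw hx p
  set H : (ι → Bool) → S → ℝ := ham ψ (fun i => x (τ i)) with hH
  set G : (ι → Bool) → S → ℝ := ham ψ (groupInd τ p) with hG
  set m := 𝔼 r, gibbs w (H r) (G r) with hm
  set q := 𝔼 r, rep n w (H r) f with hq
  set κ := 𝔼 r, gibbs w (H r) (fun a => gibbs w (H r) (K p a)) with hκ
  have hqle : |q| ≤ 1 := (Finset.abs_expect_le _ _).trans
    (Finset.expect_le Finset.univ_nonempty fun r _ => abs_gibbs_le_of_le (hw.prod n) _ hf)
  -- Concentration of the field makes it asymptotically uncorrelated with `f`. Integrating both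
  -- sides by parts and dividing by `x p` then gives the identity.
  have h3 : |𝔼 r, rep n w (H r) (fun z => f z * G r (z l)) - q * m| ≤ fluct w ψ τ p x := by
    have e : 𝔼 r, rep n w (H r) (fun z => f z * G r (z l)) - q * m
        = 𝔼 r, rep n w (H r) (fun z => f z * (G r (z l) - m)) := by
      rw [hq, Finset.expect_mul, ← Finset.expect_sub_distrib]
      refine Finset.expect_congr rfl fun r _ => ?_
      unfold rep
      rw [← gibbs_mul_const, ← gibbs_sub]
      simp only [mul_sub]
    rw [e]
    refine (Finset.abs_expect_le _ _).trans (Finset.expect_le_expect fun r _ => ?_)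
    refine (abs_gibbs_le (hw.prod n) _ _).trans ?_
    refine (gibbs_mono (hw.prod n) _ (g := fun z => |G r (z l) - m|) fun z => ?_).trans
      (rep_eval hw (H r) (fun a => |G r a - m|) l).le
    rw [abs_mul]
    exact mul_le_of_le_one_left (abs_nonneg _) (hf z)
  -- The self-overlap is 1, so the term `l' = l` contributes `q`, which cancels the same term coming
  -- from `q * m`.
  have e1 : ∀ r, rep n w (H r) (fun z => f z * ∑ l', K p (z l) (z l'))
      = rep n w (H r) f
        + rep n w (H r) (fun z => f z * ∑ l' ∈ Finset.univ.erase l, K p (z l) (z l')) :=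
    fun r => by
      unfold rep
      rw [← gibbs_add]
      congr 1
      ext z
      rw [← Finset.add_sum_erase _ _ (Finset.mem_univ l), h.diag]
      ring
  simp only [e1, Finset.expect_sub_distrib, Finset.expect_add_distrib, ← Finset.mul_expect,
    ← hq] at h1
  rw [le_div_iff₀ hp,
    show ∀ t : ℝ, |t| * x p = |t * x p| from fun t => by rw [abs_mul, abs_of_pos hp]]
  have h4 : |q * (m - x p * (1 - κ))| ≤ ibpError ι δ X 1 := by
    rw [abs_mul]
    exact (mul_le_of_le_one_left (abs_nonneg _) hqle).trans h2
  rw [abs_le] at h1 h3 h4 ⊢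
  constructor <;> nlinarith [h1.1, h1.2, h3.1, h3.2, h4.1, h4.2]

end Features

/-! ### Averaging over the amplitudes. -/

section Averaging

/-- Averaging over a product is unchanged by first averaging over one coordinate. -/
lemma expect_expect_update {α κ : Type*} [Fintype α] [DecidableEq α] [Fintype κ] [Nonempty κ]
    (p : α) (f : (α → κ) → ℝ) : 𝔼 y, 𝔼 j, f (Function.update y p j) = 𝔼 y, f y := by
  have h1 : ∑ y, ∑ j, f (Function.update y p j) = ∑ y, ∑ _j : κ, f y := by
    rw [← Fintype.sum_prod_type', ← Fintype.sum_prod_type' (fun (y : α → κ) (_ : κ) => f y)]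
    have hinv : Function.Involutive
        (fun yj : (α → κ) × κ => (Function.update yj.1 p yj.2, yj.1 p)) := fun yj => by
      simp
    exact Fintype.sum_equiv hinv.toPerm _ _ fun yj => rfl
  simp only [Fintype.expect_eq_sum_div_card, ← Finset.sum_div, h1, Finset.sum_const,
    Finset.card_univ, nsmul_eq_mul, ← Finset.mul_sum]
  have : (Fintype.card κ : ℝ) ≠ 0 := by exact_mod_cast Fintype.card_ne_zero
  field_simp

variable {S ι : Type*} [Fintype S] [Fintype ι] [DecidableEq ι] {w : S → ℝ} {P : ℕ}
  {ψ : ι → S → ℝ} {τ : ι → Fin P} {K : Fin P → S → S → ℝ} {δ : ℝ}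

/-- Amplitudes on a grid of mesh `1 / T`. -/
noncomputable def amplitude (X T : ℕ) {Y : ℕ} (y : Fin P → Fin (Y * T)) (p : Fin P) : ℝ :=
  X + (y p : ℕ) * (1 / (T : ℝ))

lemma amplitude_bounds {X T Y : ℕ} (hT : 0 < T) (hYX : Y ≤ X) (y : Fin P → Fin (Y * T))
    (p : Fin P) : (X : ℝ) ≤ amplitude X T y p ∧ amplitude X T y p ≤ 2 * X := by
  have hT' : (0 : ℝ) < T := by exact_mod_cast hT
  have h1 : ((y p : ℕ) : ℝ) ≤ Y * T := by exact_mod_cast (y p).2.le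
  have h2 : ((y p : ℕ) : ℝ) * (1 / (T : ℝ)) ≤ Y := by
    rw [mul_one_div, div_le_iff₀ hT']; exact h1
  have h3 : 0 ≤ ((y p : ℕ) : ℝ) * (1 / (T : ℝ)) := by positivity
  have h4 : (Y : ℝ) ≤ X := by exact_mod_cast hYX
  unfold amplitude
  constructor <;> linarith

/-- Concentration is applied in the amplitude of group `p` alone, the others being frozen. The mesh
`T`, which must grow with the feature system, cancels from the bound; this makes the choice of `X`
and `Y` uniform over systems. -/
lemma IsFeatureSystem.sum_fluct_le (h : IsFeatureSystem ψ τ K δ) (hw : IsWeight w)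
    {X Y T m : ℕ} (hT : 0 < T) (hTδ : Fintype.card ι * δ ≤ T) (hY : 0 < Y) (hm : 0 < m)
    (hX : Y + m ≤ X) (hP : 0 < P) (herr : ibpError ι δ (2 * X) 1 ≤ 1) (p : Fin P)
    (y : Fin P → Fin (Y * T)) :
    𝔼 j, fluct w ψ τ p (amplitude X T (Function.update y p j))
      ≤ 1 / 2 + (Real.exp 2 + 4 * m) * (5 * X) / Y + 12 * X * P / m := by
  have hT' : (0 : ℝ) < T := by exact_mod_cast hT
  have hY' : (0 : ℝ) < Y := by exact_mod_cast hY
  have hm' : (0 : ℝ) < m := by exact_mod_cast hm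
  have hX' : (Y : ℝ) + m ≤ X := by exact_mod_cast hX
  have hX1 : (1 : ℝ) ≤ X := by exact_mod_cast (by omega : 1 ≤ X)
  have hP1 : (1 : ℝ) ≤ P := by exact_mod_cast hP
  set x : Fin P → ℝ := amplitude X T y with hx
  set xt : ℝ → Fin P → ℝ := fun t => Function.update x p t with hxt
  set G : (ι → Bool) → S → ℝ := ham ψ (groupInd τ p) with hG
  set W : (ι → Bool) → S → ℝ := ham ψ (fun i => xt 0 (τ i)) with hW
  have hham : ∀ t r, ham ψ (fun i => xt t (τ i)) r = fun a => W r a + t * G r a := fun t r => by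
    ext a
    simp only [hW, hG, ham]
    rw [Finset.mul_sum, ← Finset.sum_add_distrib]
    refine Finset.sum_congr rfl fun i _ => ?_
    simp only [hxt, groupInd, Function.update_apply]
    split_ifs <;> ring
  have hupd : ∀ j, amplitude X T (Function.update y p j) = xt (X + (j : ℕ) * (1 / (T : ℝ))) :=
    fun j => by
      ext p'
      simp only [hxt, hx, amplitude, Function.update_apply]
      split_ifs <;> rfl
  have hxtle : ∀ t : ℝ, 0 ≤ t → t ≤ 2 * X → ∀ p', |xt t p'| ≤ 2 * X := fun t h0 h1 p' => by
    simp only [hxt, Function.update_apply]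
    split_ifs
    · rwa [abs_of_nonneg h0]
    · have := amplitude_bounds hT (by omega : Y ≤ X) y p'
      rw [abs_le]
      constructor <;> simp only [hx] <;> linarith
  have hrange : ∀ t : ℝ, (X : ℝ) - (m * T : ℕ) * (1 / (T : ℝ)) ≤ t →
      t ≤ X + (Y * T : ℕ) * (1 / (T : ℝ)) + (m * T : ℕ) * (1 / (T : ℝ)) →
      0 ≤ t ∧ t ≤ 2 * X := fun t h1 h2 => by
    have e1 : ((m * T : ℕ) : ℝ) * (1 / (T : ℝ)) = m := by push_cast; field_simp
    have e2 : ((Y * T : ℕ) : ℝ) * (1 / (T : ℝ)) = Y := by push_cast; field_simp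
    rw [e1] at h1
    rw [e1, e2] at h2
    constructor <;> linarith
  have hGB : ∀ r a, |G r a| ≤ Fintype.card ι * δ := fun r a => by
    refine (Finset.abs_sum_le_sum_abs _ _).trans ?_
    refine (Finset.sum_le_card_nsmul _ _ δ fun i _ => ?_).trans (by simp)
    rw [abs_mul, abs_sgn, one_mul, abs_mul]
    exact (mul_le_of_le_one_left (abs_nonneg _) (abs_groupInd_le τ p i)).trans (h.small i a)
  -- With `q = m * T` the long step has length `m`. The variance `2 (2 X) ^ 2 P` is at most `(4 X P)
  -- ^ 2`, and the mean is at most `2 * 2 X + 1 ≤ 5 X`.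
  have key := sum_expect_gibbs_abs_sub_le hw W G (u := 1 / (T : ℝ)) (B := Fintype.card ι * δ)
    (t₀ := X) (V := 4 * X * P) (c := 5 * X) (K := Y * T) (q := m * T) (by positivity)
    (by positivity) hGB (by rw [one_div_mul_eq_div, div_le_one hT']; exact hTδ)
    (fun t h1 h2 => by
      obtain ⟨h3, h4⟩ := hrange t h1 h2
      refine expect_abs_sub_le _ (by positivity) ?_
      have hv := variance_freeEnergy_le hw (ψ := ψ) (x := fun i => xt t (τ i))
        (fun i => hxtle t h3 h4 (τ i)) (fun a => (h.sum_sq a).le)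
      simp only [hham] at hv
      refine hv.trans ?_
      nlinarith [sq_nonneg (X : ℝ)])
    (fun t h1 h2 => by
      obtain ⟨h3, h4⟩ := hrange t h1 h2
      have hv := h.abs_mean_sub_le hw (hxtle t h3 h4) p
      simp only [hham] at hv
      set κ := 𝔼 r, gibbs w (fun a => W r a + t * G r a)
        (fun a => gibbs w (fun a => W r a + t * G r a) (K p a))
      have hκ : |κ| ≤ 1 := (Finset.abs_expect_le _ _).trans
        (Finset.expect_le Finset.univ_nonempty fun r _ => abs_gibbs_le_of_le hw _ fun a =>
          abs_gibbs_le_of_le hw _ fun b => h.abs_le_one p a b)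
      have ht : xt t p = t := by simp [hxt]
      rw [ht] at hv
      rw [abs_le] at hκ
      have hv' := abs_le.1 (hv.trans herr)
      rw [abs_le]
      constructor <;> nlinarith [hv'.1, hv'.2, hκ.1, hκ.2])
  have e1 : 𝔼 j, fluct w ψ τ p (amplitude X T (Function.update y p j))
      = (∑ j ∈ Finset.range (Y * T), 𝔼 r, gibbs w
          (fun a => W r a + (X + j * (1 / (T : ℝ))) * G r a) (fun a =>
        |G r a - 𝔼 s, gibbs w (fun a => W s a + (X + j * (1 / (T : ℝ))) * G s a) (G s)|))
        / (Y * T) := by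
    rw [Fintype.expect_eq_sum_div_card, Fintype.card_fin, ← Fin.sum_univ_eq_sum_range (fun j =>
      𝔼 r, gibbs w (fun a => W r a + (X + j * (1 / (T : ℝ))) * G r a) (fun a =>
        |G r a - 𝔼 s, gibbs w (fun a => W s a + (X + j * (1 / (T : ℝ))) * G s a) (G s)|))]
    push_cast
    congr 1
    refine Finset.sum_congr rfl fun j _ => ?_
    unfold fluct
    simp only [hupd, hham]
    rfl
  rw [e1, div_le_iff₀ (by positivity)]
  refine key.trans (le_of_eq ?_)
  push_cast
  field_simp
  ring

/-- For suitable amplitudes, depending only on the number of kernels and the precision, the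
fluctuations are small on average relative to the amplitude. -/
lemma exists_amplitudes {P : ℕ} (hP : 0 < P) {η : ℝ} (hη : 0 < η) :
    ∃ X Y : ℕ, 0 < Y ∧ Y ≤ X ∧
      ∀ {S ι : Type} [Fintype S] [Fintype ι] [DecidableEq ι] {w : S → ℝ} {ψ : ι → S → ℝ}
        {τ : ι → Fin P} {K : Fin P → S → S → ℝ} {δ : ℝ} {T : ℕ}, IsWeight w →
        IsFeatureSystem ψ τ K δ → 0 < T → Fintype.card ι * δ ≤ T →
        ibpError ι δ (2 * X) 1 ≤ 1 → ∀ p : Fin P,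
        𝔼 y : Fin P → Fin (Y * T), fluct w ψ τ p (amplitude X T y) ≤ η * X := by
  -- In turn `m`, `Y` and `X` make each of the three terms of `sum_fluct_le` at most `η X / 3`;
  -- moreover `X ≥ Y + m` keeps all shifted amplitudes in `[0, 2 X]`.
  obtain ⟨m, hm⟩ := exists_nat_gt (36 * P / η)
  have hP' : (0 : ℝ) < P := by exact_mod_cast hP
  have hm0 : (0 : ℝ) < m := lt_trans (by positivity) hm
  obtain ⟨Y, hY⟩ := exists_nat_gt (15 * (Real.exp 2 + 4 * m) / η)
  have hY0 : (0 : ℝ) < Y := lt_trans (by positivity) hY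
  obtain ⟨X₀, hX₀⟩ := exists_nat_gt (3 / (2 * η))
  refine ⟨X₀ + (Y + m), Y, by exact_mod_cast hY0, by omega, ?_⟩
  intro S ι _ _ _ w ψ τ K δ T hw h hT hTδ herr p
  have hYT : 0 < Y * T := Nat.mul_pos (by exact_mod_cast hY0) hT
  have : Nonempty (Fin (Y * T)) := ⟨⟨0, hYT⟩⟩
  rw [← expect_expect_update p]
  refine Finset.expect_le Finset.univ_nonempty fun y _ => ?_
  refine (h.sum_fluct_le hw hT hTδ (by exact_mod_cast hY0) (by exact_mod_cast hm0)
    (by omega) hP herr p y).trans ?_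
  set X : ℝ := ((X₀ + (Y + m) : ℕ) : ℝ) with hX
  have hX0 : 3 / (2 * η) < X := by
    rw [hX]; push_cast; linarith
  have hXpos : 0 < X := lt_trans (by positivity) hX0
  rw [div_lt_iff₀ (by positivity)] at hX0
  rw [div_lt_iff₀ hη] at hm hY
  have t1 : (Real.exp 2 + 4 * m) * (5 * X) / Y ≤ η / 3 * X := by
    rw [div_le_iff₀ hY0]
    nlinarith
  have t2 : 12 * X * P / m ≤ η / 3 * X := by
    rw [div_le_iff₀ hm0]
    nlinarith
  linarith

end Averaging

/-! ### From Ghirlanda–Guerra identities to positivity. -/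

section Positivity

variable {S Ω : Type*} [Fintype S] [Fintype Ω] {w : S → ℝ}

/-- The Ghirlanda–Guerra identity with `n` replicas for the kernel `Φ`, up to an error `e`. -/
def GhirlandaGuerra (w : S → ℝ) (H : Ω → S → ℝ) (Φ : S → S → ℝ) (n : ℕ) (e : ℝ) : Prop :=
  ∀ f : (Fin n → S) → ℝ, (∀ z, |f z| ≤ 1) → ∀ l : Fin n,
    |n * 𝔼 r, rep n w (H r) (fun z => f z * gibbs w (H r) (Φ (z l)))
      - 𝔼 r, rep n w (H r) (fun z => f z * ∑ l' ∈ Finset.univ.erase l, Φ (z l) (z l'))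
      - (𝔼 r, rep n w (H r) f) * 𝔼 r, gibbs w (H r) (fun a => gibbs w (H r) (Φ a))| ≤ e

lemma GhirlandaGuerra.mono {H : Ω → S → ℝ} {Φ : S → S → ℝ} {n : ℕ} {e e' : ℝ}
    (h : GhirlandaGuerra w H Φ n e) (he : e ≤ e') : GhirlandaGuerra w H Φ n e' :=
  fun f hf l => (h f hf l).trans he

/-- The identity is linear in the kernel, so it passes from powers of the overlap to polynomials. -/
lemma GhirlandaGuerra.sum {κ : Type*} (s : Finset κ) {H : Ω → S → ℝ} {K : κ → S → S → ℝ}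
    {n : ℕ} {e : κ → ℝ} (c : κ → ℝ) (h : ∀ k ∈ s, GhirlandaGuerra w H (K k) n (e k)) :
    GhirlandaGuerra w H (fun a b => ∑ k ∈ s, c k * K k a b) n (∑ k ∈ s, |c k| * e k) := by
  intro f hf l
  have e1 : ∀ r, rep n w (H r) (fun z => f z * gibbs w (H r) (fun b => ∑ k ∈ s, c k * K k (z l) b))
      = ∑ k ∈ s, c k * rep n w (H r) (fun z => f z * gibbs w (H r) (K k (z l))) := fun r => by
    unfold rep
    simp only [gibbs_sum, gibbs_const_mul]
    simp only [← gibbs_const_mul (w := fun z : Fin n → S => ∏ l, w (z l)), ← gibbs_sum]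
    congr 1
    ext z
    rw [Finset.mul_sum]
    exact Finset.sum_congr rfl fun k _ => by ring
  have e2 : ∀ r, rep n w (H r)
      (fun z => f z * ∑ l' ∈ Finset.univ.erase l, ∑ k ∈ s, c k * K k (z l) (z l'))
      = ∑ k ∈ s, c k * rep n w (H r)
        (fun z => f z * ∑ l' ∈ Finset.univ.erase l, K k (z l) (z l')) := fun r => by
    unfold rep
    simp only [← gibbs_const_mul, ← gibbs_sum]
    congr 1
    ext z
    rw [Finset.sum_comm, Finset.mul_sum]
    refine Finset.sum_congr rfl fun k _ => ?_
    rw [← Finset.mul_sum]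
    ring
  have e3 : ∀ r, gibbs w (H r) (fun a => gibbs w (H r) (fun b => ∑ k ∈ s, c k * K k a b))
      = ∑ k ∈ s, c k * gibbs w (H r) (fun a => gibbs w (H r) (K k a)) := fun r => by
    simp only [gibbs_sum, gibbs_const_mul]
  simp only [e1, e2, e3, Finset.expect_sum_comm, ← Finset.mul_expect]
  rw [Finset.mul_sum, Finset.mul_sum, ← Finset.sum_sub_distrib, ← Finset.sum_sub_distrib]
  refine (Finset.abs_sum_le_sum_abs _ _).trans (Finset.sum_le_sum fun k hk => ?_)
  refine le_trans (le_of_eq ?_) (mul_le_mul_of_nonneg_left (h k hk f hf l) (abs_nonneg (c k)))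
  rw [← abs_mul]
  congr 1
  ring

open Classical in
/-- The indicator that all overlaps of distinct replicas are at most `-θ`. -/
noncomputable def allNeg (R : S → S → ℝ) (θ : ℝ) {n : ℕ} (z : Fin n → S) : ℝ :=
  if ∀ i j, i ≠ j → R (z i) (z j) ≤ -θ then 1 else 0

open Classical in
/-- The indicator that an overlap is at most `-θ`. -/
noncomputable def neg (R : S → S → ℝ) (θ : ℝ) (a b : S) : ℝ := if R a b ≤ -θ then 1 else 0

omit [Fintype S] in
lemma allNeg_nonneg (R : S → S → ℝ) (θ : ℝ) {n : ℕ} (z : Fin n → S) : 0 ≤ allNeg R θ z := by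
  unfold allNeg; split_ifs <;> simp

omit [Fintype S] in
lemma allNeg_le_one (R : S → S → ℝ) (θ : ℝ) {n : ℕ} (z : Fin n → S) : allNeg R θ z ≤ 1 := by
  unfold allNeg; split_ifs <;> simp

omit [Fintype S] in
lemma neg_nonneg (R : S → S → ℝ) (θ : ℝ) (a b : S) : 0 ≤ neg R θ a b := by
  unfold neg; split_ifs <;> simp

omit [Fintype S] in
lemma neg_le_one (R : S → S → ℝ) (θ : ℝ) (a b : S) : neg R θ a b ≤ 1 := by
  unfold neg; split_ifs <;> simp

omit [Fintype S] in
lemma neg_anti (R : S → S → ℝ) {θ θ' : ℝ} (h : θ' ≤ θ) (a b : S) : neg R θ a b ≤ neg R θ' a b := by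
  unfold neg
  split_ifs with h1 h2
  · exact le_rfl
  · exact absurd (h1.trans (by linarith)) h2
  · exact zero_le_one
  · exact le_rfl

/-- `Φ` is, as a function of the overlap, a soft version of the indicator of `(-θ', ∞)`. -/
structure IsSoftStep (R Φ : S → S → ℝ) (θ θ' η : ℝ) : Prop where
  nonneg : ∀ a b, 0 ≤ Φ a b
  le_one_add : ∀ a b, Φ a b ≤ 1 + η
  one_le : ∀ a b, -θ' < R a b → 1 ≤ Φ a b
  le : ∀ a b, R a b ≤ -θ → Φ a b ≤ η

variable [Nonempty Ω]

/-- Adding a replica that is negatively correlated with all the previous ones. -/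
lemma expect_allNeg_succ_ge (hw : IsWeight w) {H : Ω → S → ℝ} {R Φ : S → S → ℝ}
    (hR : ∀ a b, R a b = R b a) {θ θ' η e : ℝ} (hη : 0 ≤ η) (hθ : θ' ≤ θ)
    (hΦ : IsSoftStep R Φ θ θ' η) {n : ℕ} (hn : 0 < n) (hGG : GhirlandaGuerra w H Φ n e) :
    (𝔼 r, rep n w (H r) (allNeg R θ))
        * (𝔼 r, gibbs w (H r) fun a => gibbs w (H r) (neg R θ a)) - (n * η + e)
      ≤ 𝔼 r, rep (n + 1) w (H r) (allNeg R θ') := by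
  have hn' : (0 : ℝ) < n := by exact_mod_cast hn
  set A := 𝔼 r, rep n w (H r) (allNeg R θ) with hA
  set κ := 𝔼 r, gibbs w (H r) (fun a => gibbs w (H r) (Φ a)) with hκ
  set q := 𝔼 r, gibbs w (H r) fun a => gibbs w (H r) (neg R θ a) with hq
  have hA0 : 0 ≤ A := Finset.expect_nonneg fun r _ =>
    gibbs_nonneg (hw.prod n) _ (allNeg_nonneg R θ)
  have hA1 : A ≤ 1 := Finset.expect_le Finset.univ_nonempty fun r _ =>
    gibbs_le_of_le (hw.prod n) _ (allNeg_le_one R θ)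
  have hκq : κ ≤ 1 + η - q := by
    rw [hκ, hq, ← Fintype.expect_const (ι := Ω) (1 + η), ← Finset.expect_sub_distrib]
    refine Finset.expect_le_expect fun r _ => ?_
    have : ∀ a b, Φ a b ≤ (1 + η) - neg R θ a b := fun a b => by
      unfold neg
      split_ifs with h
      · linarith [hΦ.le a b h]
      · linarith [hΦ.le_one_add a b]
    have h1 := gibbs_mono hw (H r) fun a => gibbs_mono hw (H r) fun b => this a b
    simp only [gibbs_sub, gibbs_const hw] at h1
    exact h1
  -- Union bound: if the new replica is not negatively correlated with some `z l`, then `Φ (z l) b ≥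
  -- 1` and the left side is nonpositive.
  have hpt : ∀ (z : Fin n → S) (b : S),
      allNeg R θ z * (1 - ∑ l, Φ (z l) b) ≤ allNeg R θ' (Fin.cons b z : Fin (n + 1) → S) := by
    intro z b
    have hsum : 0 ≤ ∑ l, Φ (z l) b := Finset.sum_nonneg fun l _ => hΦ.nonneg _ _
    by_cases hz : ∀ i j, i ≠ j → R (z i) (z j) ≤ -θ
    · have e1 : allNeg R θ z = 1 := if_pos hz
      rw [e1, one_mul]
      by_cases hb : ∀ l, R (z l) b ≤ -θ'
      · have e2 : allNeg R θ' (Fin.cons b z : Fin (n + 1) → S) = 1 := by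
          refine if_pos fun i j => ?_
          refine Fin.cases ?_ (fun i => ?_) i <;> refine Fin.cases ?_ (fun j => ?_) j
          · exact fun h => absurd rfl h
          · intro _
            rw [Fin.cons_zero, Fin.cons_succ, hR]
            exact hb j
          · intro _
            rw [Fin.cons_zero, Fin.cons_succ]
            exact hb i
          · intro h
            rw [Fin.cons_succ, Fin.cons_succ]
            exact (hz i j fun hij => h (by rw [hij])).trans (by linarith)
        rw [e2]
        linarith
      · push Not at hb
        obtain ⟨l, hl⟩ := hb
        have h1 := hΦ.one_le _ _ hl
        have h2 := Finset.single_le_sum (f := fun l => Φ (z l) b)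
          (fun l _ => hΦ.nonneg _ _) (Finset.mem_univ l)
        have h3 := allNeg_nonneg R θ' (Fin.cons b z : Fin (n + 1) → S)
        linarith
    · have e1 : allNeg R θ z = 0 := if_neg hz
      rw [e1, zero_mul]
      exact allNeg_nonneg _ _ _
  have h1 : A - ∑ l, 𝔼 r, rep n w (H r) (fun z => allNeg R θ z * gibbs w (H r) (Φ (z l)))
      ≤ 𝔼 r, rep (n + 1) w (H r) (allNeg R θ') := by
    rw [hA, ← Finset.expect_sum_comm, ← Finset.expect_sub_distrib]
    refine Finset.expect_le_expect fun r _ => ?_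
    rw [rep_succ]
    unfold rep
    rw [← gibbs_sum, ← gibbs_sub]
    refine gibbs_mono (hw.prod n) _ fun z => ?_
    refine le_trans (le_of_eq ?_) (gibbs_mono hw (H r) fun b => hpt z b)
    rw [gibbs_const_mul, gibbs_sub, gibbs_const hw, gibbs_sum, mul_sub, mul_one, Finset.mul_sum]
  -- On the event `allNeg R θ` the overlaps among old replicas contribute at most `η` each, so the
  -- identity leaves essentially `A * κ / n`, with `κ ≤ 1 + η - q`. Summing over `l` removes the
  -- factor `1 / n`.
  have h2 : ∀ l : Fin n,
      𝔼 r, rep n w (H r) (fun z => allNeg R θ z * gibbs w (H r) (Φ (z l)))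
        ≤ (n * η * A + A * (1 - q) + e) / n := fun l => by
    have h3 := (abs_le.1 (hGG (allNeg R θ)
      (fun z => by rw [abs_of_nonneg (allNeg_nonneg R θ z)]; exact allNeg_le_one R θ z) l)).2
    have h4 : 𝔼 r, rep n w (H r)
        (fun z => allNeg R θ z * ∑ l' ∈ Finset.univ.erase l, Φ (z l) (z l'))
        ≤ (n - 1) * η * A := by
      rw [hA, Finset.mul_expect]
      refine Finset.expect_le_expect fun r _ => ?_
      unfold rep
      rw [← gibbs_const_mul]
      refine gibbs_mono (hw.prod n) _ fun z => ?_
      by_cases hz : ∀ i j, i ≠ j → R (z i) (z j) ≤ -θ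
      · have e1 : allNeg R θ z = 1 := if_pos hz
        rw [e1, one_mul, mul_one]
        refine (Finset.sum_le_card_nsmul _ _ η fun l' hl' =>
          hΦ.le _ _ (hz _ _ (Finset.ne_of_mem_erase hl').symm)).trans (le_of_eq ?_)
        rw [Finset.card_erase_of_mem (Finset.mem_univ l), Finset.card_univ, Fintype.card_fin,
          nsmul_eq_mul, Nat.cast_sub hn, Nat.cast_one]
      · have e1 : allNeg R θ z = 0 := if_neg hz
        rw [e1, zero_mul, mul_zero]
    rw [le_div_iff₀ hn']
    have h5 := mul_le_mul_of_nonneg_left hκq hA0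
    rw [← hA, ← hκ] at h3
    nlinarith
  have h6 := Finset.sum_le_card_nsmul Finset.univ _ _ fun l (_ : l ∈ Finset.univ) => h2 l
  rw [Finset.card_univ, Fintype.card_fin, nsmul_eq_mul, mul_div_cancel₀ _ hn'.ne'] at h6
  have h7 : n * η * A ≤ n * η := mul_le_of_le_one_right (by positivity) hA1
  linarith

/-- If `m` replicas cannot all be pairwise negatively correlated, then the probability that two
replicas are negatively correlated is small. -/
lemma pow_expect_neg_le (hw : IsWeight w) {H : Ω → S → ℝ} {R : S → S → ℝ}
    (hR : ∀ a b, R a b = R b a) {θ : ℕ → ℝ} (hθ : Antitone θ) {Φ : ℕ → S → S → ℝ} {η e : ℝ}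
    (hη : 0 ≤ η) (he : 0 ≤ e) {m : ℕ}
    (hΦ : ∀ n < m, IsSoftStep R (Φ n) (θ n) (θ (n + 1)) η)
    (hGG : ∀ n < m, GhirlandaGuerra w H (Φ n) (n + 1) e)
    (hm : ∀ z : Fin (m + 1) → S, allNeg R (θ m) z = 0) :
    (𝔼 r, gibbs w (H r) fun a => gibbs w (H r) (neg R (θ 0) a)) ^ m ≤ m * (m * η + e) := by
  set q := 𝔼 r, gibbs w (H r) fun a => gibbs w (H r) (neg R (θ 0) a) with hq
  have hq0 : 0 ≤ q := Finset.expect_nonneg fun r _ => gibbs_nonneg hw _ fun a =>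
    gibbs_nonneg hw _ fun b => neg_nonneg _ _ _ _
  have hq1 : q ≤ 1 := Finset.expect_le Finset.univ_nonempty fun r _ => gibbs_le_of_le hw _
    fun a => gibbs_le_of_le hw _ fun b => neg_le_one _ _ _ _
  have key : ∀ n ≤ m, q ^ n - n * (m * η + e)
      ≤ 𝔼 r, rep (n + 1) w (H r) (allNeg R (θ n)) := by
    intro n
    induction n with
    | zero =>
      intro _
      have : ∀ z : Fin 1 → S, allNeg R (θ 0) z = 1 := fun z =>
        if_pos fun i j h => absurd (Subsingleton.elim i j) h
      have e1 : ∀ r, rep (0 + 1) w (H r) (allNeg R (θ 0)) = 1 := fun r => by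
        rw [show (allNeg R (θ 0) : (Fin (0 + 1) → S) → ℝ) = fun _ => 1 from funext this]
        exact gibbs_const (hw.prod _) _ _
      simp [e1]
    | succ n ih =>
      intro hn
      have h1 := ih (by omega)
      have h2 := expect_allNeg_succ_ge hw hR hη (hθ (Nat.le_succ n)) (hΦ n (by omega))
        (Nat.succ_pos n) (hGG n (by omega))
      -- The thresholds relax along the induction, leaving room for a soft step each time; relaxing
      -- only enlarges the event, so `q` at level `θ 0` remains a lower bound.
      have h3 : q ≤ 𝔼 r, gibbs w (H r) fun a => gibbs w (H r) (neg R (θ n) a) :=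
        Finset.expect_le_expect fun r _ => gibbs_mono hw _ fun a => gibbs_mono hw _ fun b =>
          neg_anti R (hθ (Nat.zero_le n)) a b
      set A := 𝔼 r, rep (n + 1) w (H r) (allNeg R (θ n)) with hA
      have hA0 : 0 ≤ A := Finset.expect_nonneg fun r _ =>
        gibbs_nonneg (hw.prod _) _ (allNeg_nonneg R _)
      refine le_trans ?_ h2
      have h4 := mul_le_mul_of_nonneg_left h3 hA0
      have h5 := mul_le_mul_of_nonneg_right h1 hq0
      have hn' : ((n + 1 : ℕ) : ℝ) ≤ m := by exact_mod_cast hn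
      have h6 := mul_le_mul_of_nonneg_right hn' hη
      have h7 : (n : ℝ) * (m * η + e) * q ≤ n * (m * η + e) :=
        mul_le_of_le_one_right (by positivity) hq1
      rw [pow_succ]
      push_cast at *
      nlinarith
  have h1 := key m le_rfl
  have e1 : ∀ r, rep (m + 1) w (H r) (allNeg R (θ m)) = 0 := fun r => by
    rw [show (allNeg R (θ m) : (Fin (m + 1) → S) → ℝ) = fun _ => 0 from funext hm]
    exact gibbs_const (hw.prod _) _ _
  simp only [e1, Finset.expect_const_zero] at h1
  linarith

end Positivity

/-! ### Soft steps, monomial features and positivity for finitely many points. -/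

/-- A polynomial which is a soft step function on `[-1, 1]`. -/
lemma exists_polynomial_softStep {θ θ' η : ℝ} (hθ : θ' < θ) (hη : 0 < η) :
    ∃ p : Polynomial ℝ, ∀ t ∈ Set.Icc (-1 : ℝ) 1, 0 ≤ p.eval t ∧ p.eval t ≤ 1 + η ∧
      (-θ' < t → 1 ≤ p.eval t) ∧ (t ≤ -θ → p.eval t ≤ η) := by
  set s : ℝ → ℝ := fun t => max 0 (min 1 ((t + θ) / (θ - θ'))) with hs
  have hc : Continuous s := by fun_prop
  obtain ⟨p, hp⟩ := exists_polynomial_near_of_continuousOn (-1) 1 s hc.continuousOn (η / 2)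
    (by positivity)
  -- Raising the Weierstrass approximation of the ramp by `η / 2` makes its error one-sided.
  refine ⟨p + Polynomial.C (η / 2), fun t ht => ?_⟩
  have h1 := abs_lt.1 (hp t ht)
  rw [Polynomial.eval_add, Polynomial.eval_C]
  have hs0 : 0 ≤ s t := le_max_left _ _
  have hs1 : s t ≤ 1 := max_le zero_le_one (min_le_left _ _)
  have hpos : 0 < θ - θ' := by linarith
  refine ⟨by linarith, by linarith, fun h => ?_, fun h => ?_⟩
  · have : s t = 1 := by
      have : 1 ≤ (t + θ) / (θ - θ') := by rw [le_div_iff₀ hpos]; linarith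
      simp only [hs]
      rw [min_eq_left this]
      simp
    linarith
  · have : s t = 0 := by
      have : (t + θ) / (θ - θ') ≤ 0 := div_nonpos_of_nonpos_of_nonneg (by linarith) hpos.le
      simp only [hs]
      exact max_eq_left ((min_le_right _ _).trans this)
    linarith

/-- Many unit vectors cannot be pairwise negatively correlated. -/
lemma exists_inner_gt {E : Type*} [NormedAddCommGroup E] [InnerProductSpace ℝ E] {n : ℕ}
    (z : Fin (n + 1) → E) (hz : ∀ i, ‖z i‖ = 1) {θ : ℝ} (hθ : 1 < n * θ) :
    ∃ i j, i ≠ j ∧ -θ < inner ℝ (z i) (z j) := by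
  by_contra! h
  have h1 : 0 ≤ inner ℝ (∑ i, z i) (∑ i, z i) := real_inner_self_nonneg
  rw [sum_inner] at h1
  simp only [inner_sum] at h1
  have h2 : ∀ i, ∑ j, inner ℝ (z i) (z j) ≤ 1 + n * -θ := fun i => by
    rw [← Finset.add_sum_erase _ _ (Finset.mem_univ i), real_inner_self_eq_norm_sq, hz]
    have := Finset.sum_le_card_nsmul (Finset.univ.erase i) (fun j => inner ℝ (z i) (z j)) (-θ)
      fun j hj => h i j (Finset.ne_of_mem_erase hj).symm
    rw [Finset.card_erase_of_mem (Finset.mem_univ i), Finset.card_univ, Fintype.card_fin,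
      nsmul_eq_mul, Nat.add_sub_cancel] at this
    linarith
  have h3 := Finset.sum_le_card_nsmul Finset.univ _ _ fun i (_ : i ∈ Finset.univ) => h2 i
  rw [Finset.card_univ, Fintype.card_fin, nsmul_eq_mul] at h3
  have h4 : ((n + 1 : ℕ) : ℝ) * (1 + n * -θ) < 0 :=
    mul_neg_of_pos_of_neg (by positivity) (by linarith)
  linarith

lemma abs_coord_le {N : ℕ} (z : EuclideanSpace ℝ (Fin N)) (hz : ‖z‖ = 1) (i : Fin N) :
    |z i| ≤ 1 := by
  have := PiLp.norm_apply_le z i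
  rwa [hz, Real.norm_eq_abs] at this

/-- Monomial features realise the powers of the overlap as covariances. -/
lemma exists_featureSystem {N : ℕ} {S : Type} [Fintype S] (z : S → EuclideanSpace ℝ (Fin N))
    (hz : ∀ a, ‖z a‖ = 1) (P n : ℕ) (X : ℝ) {e : ℝ} (he : 0 < e) :
    ∃ (ι : Type) (_ : Fintype ι) (_ : DecidableEq ι) (ψ : ι → S → ℝ) (τ : ι → Fin P) (δ : ℝ),
      IsFeatureSystem ψ τ (fun p a b => inner ℝ (z a) (z b) ^ (p : ℕ)) δ ∧ 0 ≤ δ ∧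
        ibpError ι δ X n ≤ e := by
  set c : ℝ := (Fintype.card (Σ p : Fin P, (Fin p → Fin N)) : ℝ) with hc
  obtain ⟨M, hM⟩ := exists_nat_gt (c * (12 * (n * X) ^ 2) / e)
  have hc0 : 0 ≤ c := Nat.cast_nonneg _
  have hM0 : (0 : ℝ) < M := lt_of_le_of_lt (by positivity) hM
  -- Each monomial is repeated `M ^ 2` times with weight `1 / M`: covariances are unchanged, while
  -- the integration by parts error becomes of order `1 / M`.
  refine ⟨(Σ p : Fin P, (Fin p → Fin N)) × Fin (M ^ 2), inferInstance, Classical.decEq _,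
    fun i a => (1 / (M : ℝ)) * ∏ l, z a (i.1.2 l), fun i => i.1.1, 1 / M, ?_, by positivity, ?_⟩
  · refine ⟨fun i a => ?_, fun p a b => ?_, fun p a => ?_, fun p a b => ?_⟩
    · rw [abs_mul, abs_of_pos (by positivity : (0 : ℝ) < 1 / M), Finset.abs_prod]
      exact mul_le_of_le_one_right (by positivity)
        (Finset.prod_le_one (fun _ _ => abs_nonneg _) fun l _ => abs_coord_le _ (hz a) _)
    · have e1 : (inner ℝ (z a) (z b) : ℝ) = ∑ k, z a k * z b k := by
        simp [PiLp.inner_apply, mul_comm]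
      rw [e1, Fintype.sum_pow, Fintype.sum_prod_type, Fintype.sum_sigma,
        Finset.sum_eq_single p (fun p' _ hp' => by simp [hp']) (by simp)]
      simp only [if_true, Finset.prod_mul_distrib]
      refine Finset.sum_congr rfl fun I _ => ?_
      change ∑ _j : Fin (M ^ 2), (1 / (M : ℝ) * ∏ l : Fin p, z a (I l))
        * (1 / (M : ℝ) * ∏ l : Fin p, z b (I l)) = _
      rw [Finset.sum_const, Finset.card_univ, Fintype.card_fin, nsmul_eq_mul]
      push_cast
      field_simp
    · simp [hz]
    · rw [abs_pow]
      refine pow_le_one₀ (abs_nonneg _) ((abs_real_inner_le_norm _ _).trans ?_)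
      simp [hz]
  · unfold ibpError
    rw [Fintype.card_prod, Fintype.card_fin]
    rw [div_lt_iff₀ he] at hM
    push_cast
    rw [← hc]
    have : c * (M : ℝ) ^ 2 * (12 * (1 / M) * (n * (X * (1 / M))) ^ 2)
        = c * (12 * (n * X) ^ 2) / M := by
      field_simp
    rw [this, div_le_iff₀ hM0]
    linarith

lemma expect_pow_le {κ : Type*} [Fintype κ] [Nonempty κ] (f : κ → ℝ) (hf : ∀ k, 0 ≤ f k)
    (m : ℕ) : (𝔼 k, f k) ^ m ≤ 𝔼 k, f k ^ m := by
  have h := Real.pow_arith_mean_le_arith_mean_pow Finset.univ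
    (fun _ : κ => 1 / (Fintype.card κ : ℝ)) f (fun _ _ => by positivity)
    (by simp) (fun k _ => hf k) m
  simpa only [Fintype.expect_eq_sum_div_card, one_div_mul_eq_div, ← Finset.sum_div] using h

lemma ibpError_mono {ι : Type*} [Fintype ι] {δ X : ℝ} (hδ : 0 ≤ δ) {n m : ℕ} (h : n ≤ m) :
    ibpError ι δ X n ≤ ibpError ι δ X m := by
  have h1 : (n : ℝ) ≤ m := by exact_mod_cast h
  unfold ibpError
  simp only [mul_pow]
  gcongr

/-- Talagrand's positivity principle for finitely many configurations: a random Hamiltonian of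
variance bounded in terms of `ε` makes overlaps below `-ε` unlikely, whatever the weights. -/
theorem exists_random_hamiltonian {ε : ℝ} (hε : 0 < ε) :
    ∃ D : ℝ, 0 < D ∧ ∀ {N : ℕ} {S : Type} [Fintype S] (z : S → EuclideanSpace ℝ (Fin N)),
      (∀ a, ‖z a‖ = 1) → ∃ (ι Θ : Type) (_ : Fintype ι) (_ : DecidableEq ι) (_ : Fintype Θ)
        (_ : Nonempty Θ) (ψ : ι → S → ℝ) (x : Θ → ι → ℝ),
        (∀ θ a, ∑ i, (x θ i * ψ i a) ^ 2 ≤ D) ∧ ∀ w : S → ℝ, IsWeight w →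
          𝔼 θ, 𝔼 r, gibbs w (ham ψ (x θ) r) (fun a => gibbs w (ham ψ (x θ) r)
            (neg (fun a b => inner ℝ (z a) (z b)) ε a)) ≤ ε := by
  obtain ⟨m, hm⟩ := exists_nat_gt (2 / ε)
  have hm0 : (0 : ℝ) < m := lt_trans (by positivity) hm
  have hm0' : 0 < m := by exact_mod_cast hm0
  rw [div_lt_iff₀ hε] at hm
  -- The thresholds go from `ε` to `ε / 2` in `m` steps; since `m * (ε / 2) > 1`, no `m + 1` unit
  -- vectors have all overlaps below the last one.
  set θ : ℕ → ℝ := fun n => ε * (1 - n / (2 * m)) with hθ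
  have hθlt : ∀ n, θ (n + 1) < θ n := fun n => by
    refine mul_lt_mul_of_pos_left ?_ hε
    push_cast
    rw [add_div]
    have : 0 < 1 / (2 * (m : ℝ)) := by positivity
    linarith
  have hθanti : Antitone θ := antitone_nat_of_succ_le fun n => (hθlt n).le
  set η : ℝ := ε ^ m / (2 * m ^ 2) with hη
  have hη0 : 0 < η := by positivity
  choose q hq using fun n => exists_polynomial_softStep (hθlt n) hη0
  set P : ℕ := 1 + ∑ n ∈ Finset.range m, (q n).natDegree with hP
  have hPdeg : ∀ n < m, (q n).natDegree < P := fun n hn => by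
    have := Finset.single_le_sum (f := fun n => (q n).natDegree) (fun _ _ => Nat.zero_le _)
      (Finset.mem_range.2 hn)
    omega
  set C : ℝ := ∑ n ∈ Finset.range m, ∑ p : Fin P, |(q n).coeff p| with hC
  have hC0 : 0 ≤ C := Finset.sum_nonneg fun _ _ => Finset.sum_nonneg fun _ _ => abs_nonneg _
  -- Chosen, like `η`, so that its share of the final error `m * (m * η + e)` is at most `ε ^ m /
  -- 2`. Everything up to `X` and `Y` is fixed by `ε` alone.
  set ζ : ℝ := ε ^ m / (8 * m * (C + 1)) with hζ
  have hζ0 : 0 < ζ := by positivity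
  obtain ⟨X, Y, hY, hYX, hXY⟩ := exists_amplitudes (P := P) (by omega) hζ0
  have hX1 : (1 : ℝ) ≤ X := by exact_mod_cast (by omega : 1 ≤ X)
  refine ⟨(2 * X) ^ 2 * P, by
    have : (0 : ℝ) < P := by exact_mod_cast (by omega : 0 < P)
    positivity, ?_⟩
  intro N S _ z hz
  obtain ⟨ι, iF, iD, ψ, τ, δ, hψ, hδ, herr⟩ := exists_featureSystem z hz P (m + 1) (2 * X)
    (lt_min zero_lt_one hζ0)
  obtain ⟨T₀, hT₀⟩ := exists_nat_ge (Fintype.card ι * δ)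
  have hT : 0 < T₀ + 1 := Nat.succ_pos _
  have hTδ : Fintype.card ι * δ ≤ (T₀ + 1 : ℕ) := hT₀.trans (by push_cast; linarith)
  set T := T₀ + 1
  have : Nonempty (Fin (Y * T)) := ⟨⟨0, Nat.mul_pos hY hT⟩⟩
  -- The amplitudes remain random because good ones would depend on `w`.
  refine ⟨ι, Fin P → Fin (Y * T), iF, iD, inferInstance, inferInstance, ψ,
    fun y i => amplitude X T y (τ i), fun y a => ?_, fun w hw => ?_⟩
  · rw [← hψ.sum_sq a, Finset.mul_sum]
    refine Finset.sum_le_sum fun i _ => ?_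
    rw [mul_pow]
    refine mul_le_mul_of_nonneg_right ?_ (sq_nonneg _)
    have := amplitude_bounds hT hYX y (τ i)
    exact pow_le_pow_left₀ (by linarith) this.2 2
  set K : Fin P → S → S → ℝ := fun p a b => inner ℝ (z a) (z b) ^ (p : ℕ) with hK
  set R : S → S → ℝ := fun a b => inner ℝ (z a) (z b) with hR
  set Φ : ℕ → S → S → ℝ := fun n a b => ∑ p : Fin P, (q n).coeff p * K p a b with hΦ
  have hΦeval : ∀ n < m, ∀ a b, Φ n a b = (q n).eval (R a b) := fun n hn a b => by
    rw [Polynomial.eval_eq_sum_range' (hPdeg n hn), ← Fin.sum_univ_eq_sum_range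
      (fun i => (q n).coeff i * R a b ^ i)]
  have hRmem : ∀ a b, R a b ∈ Set.Icc (-1 : ℝ) 1 := fun a b => by
    have := abs_le.1 ((abs_real_inner_le_norm (z a) (z b)).trans (by simp [hz]) : |R a b| ≤ 1)
    exact this
  have hstep : ∀ n < m, IsSoftStep R (Φ n) (θ n) (θ (n + 1)) η := fun n hn => by
    refine ⟨fun a b => ?_, fun a b => ?_, fun a b => ?_, fun a b => ?_⟩ <;>
      rw [hΦeval n hn] <;> have := hq n _ (hRmem a b)
    · exact this.1
    · exact this.2.1
    · exact this.2.2.1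
    · exact this.2.2.2
  set e : (Fin P → Fin (Y * T)) → ℝ := fun y => ∑ n ∈ Finset.range m, ∑ p : Fin P,
    |(q n).coeff p| * ((fluct w ψ τ p (amplitude X T y) + 2 * ζ) / X) with he
  have hfl : ∀ p x, 0 ≤ fluct w ψ τ p x := fun p x => Finset.expect_nonneg fun r _ =>
    gibbs_nonneg hw _ fun a => abs_nonneg _
  have he0 : ∀ (y : Fin P → Fin (Y * T)) (n : ℕ), 0 ≤ ∑ p : Fin P,
      |(q n).coeff p| * ((fluct w ψ τ p (amplitude X T y) + 2 * ζ) / X) := fun y n =>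
    Finset.sum_nonneg fun p _ => by
      have h1 := hfl p (amplitude X T y)
      positivity
  have hX0 : (0 : ℝ) ≤ X := by linarith
  have hGG : ∀ y : Fin P → Fin (Y * T), ∀ n < m, GhirlandaGuerra w (ham ψ fun i => amplitude X T y (τ i))
      (Φ n) (n + 1) (e y) := fun y n hn => by
    refine (GhirlandaGuerra.sum Finset.univ (fun p : Fin P => (q n).coeff p)
      (K := K) (e := fun p => (fluct w ψ τ p (amplitude X T y) + 2 * ζ) / X)
      fun p _ f hf l => ?_).mono
      (Finset.single_le_sum (f := fun n => ∑ p : Fin P,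
        |(q n).coeff p| * ((fluct w ψ τ p (amplitude X T y) + 2 * ζ) / X))
        (fun n _ => he0 y n) (Finset.mem_range.2 hn))
    have hb := amplitude_bounds hT hYX y
    refine (hψ.ghirlanda_guerra hw (X := 2 * X) (fun p => ?_) p (by linarith [(hb p).1]) hf
      l).trans ?_
    · rw [abs_of_nonneg (by linarith [(hb p).1])]
      exact (hb p).2
    · have e1 := (ibpError_mono (ι := ι) (X := 2 * X) hδ (by omega : n + 1 ≤ m + 1)).trans
        (herr.trans (min_le_right _ _))
      have e2 := (ibpError_mono (ι := ι) (X := 2 * X) hδ (by omega : 1 ≤ m + 1)).trans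
        (herr.trans (min_le_right _ _))
      refine div_le_div₀ ?_ ?_ (by linarith) (hb p).1
      · linarith [hfl p (amplitude X T y)]
      · linarith
  have havg : 𝔼 y, e y ≤ 3 * ζ * C := by
    simp only [he, Finset.expect_sum_comm, ← Finset.mul_expect, ← Finset.expect_div,
      Finset.expect_add_distrib, Fintype.expect_const]
    rw [hC, Finset.mul_sum]
    refine Finset.sum_le_sum fun n _ => ?_
    rw [Finset.mul_sum]
    refine Finset.sum_le_sum fun p _ => ?_
    rw [mul_comm (3 * ζ)]
    refine mul_le_mul_of_nonneg_left ?_ (abs_nonneg _)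
    have h1 := hXY hw hψ hT hTδ ((ibpError_mono hδ (by omega)).trans
      (herr.trans (min_le_left _ _))) p
    rw [div_le_iff₀ (by linarith)]
    nlinarith
  have hemp : ∀ v : Fin (m + 1) → S, allNeg R (θ m) v = 0 := fun v => by
    refine if_neg fun h => ?_
    have e1 : θ m = ε / 2 := by
      simp only [hθ]
      field_simp
      norm_num
    obtain ⟨i, j, hij, hlt⟩ := exists_inner_gt (fun i => z (v i)) (fun i => hz _)
      (θ := θ m) (by rw [e1]; linarith)
    exact absurd (h i j hij) (not_le.2 hlt)
  have hθ0 : θ 0 = ε := by simp [hθ]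
  have hpow : ∀ y : Fin P → Fin (Y * T), (𝔼 r, gibbs w (ham ψ (fun i => amplitude X T y (τ i)) r) (fun a =>
      gibbs w (ham ψ (fun i => amplitude X T y (τ i)) r) (neg R ε a))) ^ m
      ≤ m * (m * η + e y) := fun y => by
    have := pow_expect_neg_le hw (fun a b => real_inner_comm _ _) hθanti hη0.le
      (Finset.sum_nonneg fun n _ => he0 y n) hstep (hGG y) hemp
    rwa [hθ0] at this
  refine le_of_pow_le_pow_left₀ hm0'.ne' hε.le ?_
  -- The bound holds for the `m`-th power at each amplitude; convexity of the power lets it be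
  -- averaged.
  refine (expect_pow_le _ (fun y => Finset.expect_nonneg fun r _ => gibbs_nonneg hw _ fun a =>
    gibbs_nonneg hw _ fun b => neg_nonneg _ _ _ _) m).trans ?_
  refine (Finset.expect_le_expect fun y _ => hpow y).trans ?_
  rw [← Finset.mul_expect, Finset.expect_add_distrib, Fintype.expect_const]
  have t1 : m * (m * η) = ε ^ m / 2 := by rw [hη]; field_simp
  have t2 : m * (3 * ζ * C) ≤ ε ^ m / 2 := by
    have : m * (3 * ζ * C) = 3 / 8 * ε ^ m * (C / (C + 1)) := by rw [hζ]; field_simp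
    rw [this]
    have h1 : C / (C + 1) ≤ 1 := by rw [div_le_one (by linarith)]; linarith
    have h2 : 0 < ε ^ m := by positivity
    nlinarith
  have t3 := mul_le_mul_of_nonneg_left havg hm0.le
  linarith

/-! ### Truncation to a bounded perturbation. -/

section Truncation

/-- Subgaussianity of sign sums: the expectation factors into hyperbolic cosines, and `cosh c ≤ exp
(c ^ 2 / 2)`. -/
lemma expect_exp_le {ι : Type*} [Fintype ι] [DecidableEq ι] (c : ι → ℝ) :
    𝔼 r : ι → Bool, Real.exp (∑ i, sgn (r i) * c i) ≤ Real.exp ((∑ i, c i ^ 2) / 2) := by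
  have h1 : 𝔼 r : ι → Bool, Real.exp (∑ i, sgn (r i) * c i) = ∏ i, Real.cosh (c i) := by
    rw [Fintype.expect_eq_sum_div_card]
    simp only [Real.exp_sum]
    rw [← Fintype.prod_sum (fun i (b : Bool) => Real.exp (sgn b * c i))]
    simp only [Fintype.card_pi, Fintype.card_bool, Finset.prod_const, Finset.card_univ,
      Fintype.sum_bool, sgn_true, sgn_false, Real.cosh_eq]
    rw [Finset.prod_div_distrib]
    simp
  rw [h1, Finset.sum_div, Real.exp_sum]
  exact Finset.prod_le_prod (fun i _ => (Real.cosh_pos _).le)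
    fun i _ => Real.cosh_le_exp_half_sq (c i)

variable {S : Type*} [Fintype S] {w : S → ℝ}

/-- With `m` the average of `f` under `g`, the weights `exp g` annihilate `m - f`, so only the
difference of the exponentials survives. The sole denominator is the partition function of `H`. -/
lemma abs_gibbs_sub_gibbs_le (hw : IsWeight w) (H g f : S → ℝ) (hf : ∀ a, |f a| ≤ 1) :
    |gibbs w g f - gibbs w H f|
      ≤ 2 * ((∑ a, w a * |Real.exp (H a) - Real.exp (g a)|) / ∑ a, w a * Real.exp (H a)) := by
  have hZ := partition_pos hw H
  have hZ' := partition_pos hw g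
  have hm := abs_gibbs_le_of_le hw g hf
  set m := gibbs w g f with hmdef
  set U := ∑ a, w a * |Real.exp (H a) - Real.exp (g a)|
  have e : m - gibbs w H f
      = (∑ a, w a * (Real.exp (H a) - Real.exp (g a)) * (m - f a))
        / ∑ a, w a * Real.exp (H a) := by
    have e1 : ∑ a, w a * (Real.exp (H a) - Real.exp (g a)) * (m - f a)
        = m * (∑ a, w a * Real.exp (H a)) - m * (∑ a, w a * Real.exp (g a))
          - ∑ a, w a * Real.exp (H a) * f a + ∑ a, w a * Real.exp (g a) * f a := by
      rw [Finset.mul_sum, Finset.mul_sum, ← Finset.sum_sub_distrib, ← Finset.sum_sub_distrib,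
        ← Finset.sum_add_distrib]
      exact Finset.sum_congr rfl fun a _ => by ring
    have e2 : m * (∑ a, w a * Real.exp (g a)) = ∑ a, w a * Real.exp (g a) * f a :=
      div_mul_cancel₀ _ hZ'.ne'
    rw [e1, e2, eq_div_iff hZ.ne', sub_mul]
    unfold gibbs
    rw [div_mul_cancel₀ _ hZ.ne']
    ring
  rw [e, abs_div, abs_of_pos hZ, ← mul_div_assoc]
  refine div_le_div_of_nonneg_right ?_ hZ.le
  rw [Finset.mul_sum]
  refine (Finset.abs_sum_le_sum_abs _ _).trans (Finset.sum_le_sum fun a _ => ?_)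
  rw [abs_mul, abs_mul, abs_of_nonneg (hw.nonneg a), mul_comm 2]
  refine mul_le_mul_of_nonneg_left ?_ (mul_nonneg (hw.nonneg a) (abs_nonneg _))
  exact (abs_sub _ _).trans (by linarith [hf a])

/-- Jensen for `1 / x`, through the tangent bound `2 t - t ^ 2 y ≤ 1 / y`. It replaces a random
denominator by exponential moments. -/
lemma inv_partition_le (hw : IsWeight w) (H : S → ℝ) :
    (∑ a, w a * Real.exp (H a))⁻¹ ≤ ∑ a, w a * Real.exp (-H a) := by
  have hZ := partition_pos hw H
  set t := (∑ a, w a * Real.exp (H a))⁻¹ with ht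
  have h1 : ∀ a, w a * (2 * t) - t ^ 2 * (w a * Real.exp (H a)) ≤ w a * Real.exp (-H a) :=
    fun a => by
      have h2 : Real.exp (H a) * Real.exp (-H a) = 1 := by rw [← Real.exp_add]; simp
      have h3 : 2 * t - t ^ 2 * Real.exp (H a) ≤ Real.exp (-H a) := by
        have h4 : 0 ≤ Real.exp (-H a) * (1 - t * Real.exp (H a)) ^ 2 := by positivity
        have h5 : Real.exp (-H a) * (1 - t * Real.exp (H a)) ^ 2
            = Real.exp (-H a) - 2 * t * (Real.exp (H a) * Real.exp (-H a))
              + t ^ 2 * Real.exp (H a) * (Real.exp (H a) * Real.exp (-H a)) := by ring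
        rw [h2] at h5
        linarith
      have := mul_le_mul_of_nonneg_left h3 (hw.nonneg a)
      linarith
  have h2 := Finset.sum_le_sum fun a (_ : a ∈ Finset.univ) => h1 a
  rw [Finset.sum_sub_distrib, ← Finset.sum_mul, ← Finset.mul_sum, hw.sum_one] at h2
  have h3 : t ^ 2 * (∑ a, w a * Real.exp (H a)) = t := by
    rw [pow_two, mul_assoc, ht, inv_mul_cancel₀ hZ.ne', mul_one]
  linarith

/-- Truncation at level `C`. -/
noncomputable def truncate (C : ℝ) (H : S → ℝ) (a : S) : ℝ := max (-C) (min (H a) C)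

omit [Fintype S] in
lemma abs_truncate_le {C : ℝ} (hC : 0 ≤ C) (H : S → ℝ) (a : S) : |truncate C H a| ≤ C :=
  abs_le.2 ⟨le_max_left _ _, max_le (by linarith) (min_le_right _ _)⟩

omit [Fintype S] in
lemma abs_exp_sub_exp_truncate_le {C : ℝ} (hC : 0 ≤ C) (H : S → ℝ) (a : S) :
    |Real.exp (H a) - Real.exp (truncate C H a)|
      ≤ Real.exp (-C) * (Real.exp (2 * H a) + 1) := by
  unfold truncate
  have p1 := Real.exp_pos (-C)
  have p2 := Real.exp_pos (2 * H a)
  rcases le_total (H a) (-C) with h | h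
  · rw [min_eq_left (by linarith), max_eq_left h, abs_le]
    have := Real.exp_le_exp.2 h
    have := Real.exp_pos (H a)
    constructor <;> nlinarith
  rcases le_total (H a) C with h' | h'
  · rw [min_eq_left h', max_eq_right h, sub_self, abs_zero]
    positivity
  · rw [min_eq_right h', max_eq_right (by linarith)]
    have h1 := Real.exp_le_exp.2 h'
    have h2 : Real.exp (H a) ≤ Real.exp (-C) * Real.exp (2 * H a) := by
      rw [← Real.exp_add]
      exact Real.exp_le_exp.2 (by linarith)
    have := Real.exp_pos C
    rw [abs_of_nonneg (by linarith)]
    nlinarith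

/-- Truncating a random Hamiltonian of bounded variance hardly changes Gibbs averages. -/
lemma expect_truncation_error_le {ι : Type*} [Fintype ι] [DecidableEq ι] (hw : IsWeight w)
    {ψ : ι → S → ℝ} {x : ι → ℝ} {C D : ℝ} (hC : 0 ≤ C)
    (hD : ∀ a, ∑ i, (x i * ψ i a) ^ 2 ≤ D) :
    𝔼 r, (∑ a, w a * |Real.exp (ham ψ x r a) - Real.exp (truncate C (ham ψ x r) a)|)
        / ∑ a, w a * Real.exp (ham ψ x r a)
      ≤ 2 * Real.exp (5 * D - C) := by
  -- The factors are at most `exp (2 H)` from the truncation and `exp (-H)` from the inverse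
  -- partition function; `(s x + t y) ^ 2 ≤ 8 x ^ 2 + 2 y ^ 2` yields half of `10 D`.
  have hexp : ∀ (s t : ℝ), |s| ≤ 2 → |t| ≤ 1 → ∀ a b,
      𝔼 r, Real.exp (s * ham ψ x r a + t * ham ψ x r b) ≤ Real.exp (5 * D) := by
    intro s t hs ht a b
    have e : ∀ r, s * ham ψ x r a + t * ham ψ x r b
        = ∑ i, sgn (r i) * (s * (x i * ψ i a) + t * (x i * ψ i b)) := fun r => by
      unfold ham
      rw [Finset.mul_sum, Finset.mul_sum, ← Finset.sum_add_distrib]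
      exact Finset.sum_congr rfl fun i _ => by ring
    simp only [e]
    refine (expect_exp_le _).trans (Real.exp_le_exp.2 ?_)
    have hs2 : s ^ 2 ≤ 4 := by nlinarith [abs_nonneg s, sq_abs s]
    have ht2 : t ^ 2 ≤ 1 := by nlinarith [abs_nonneg t, sq_abs t]
    have h1 : ∑ i, (s * (x i * ψ i a) + t * (x i * ψ i b)) ^ 2
        ≤ ∑ i, (8 * (x i * ψ i a) ^ 2 + 2 * (x i * ψ i b) ^ 2) := by
      refine Finset.sum_le_sum fun i _ => ?_
      nlinarith [sq_nonneg (s * (x i * ψ i a) - t * (x i * ψ i b)),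
        mul_nonneg (sub_nonneg.2 hs2) (sq_nonneg (x i * ψ i a)),
        mul_nonneg (sub_nonneg.2 ht2) (sq_nonneg (x i * ψ i b))]
    rw [Finset.sum_add_distrib, ← Finset.mul_sum, ← Finset.mul_sum] at h1
    linarith [hD a, hD b]
  have hpt : ∀ r, (∑ a, w a * |Real.exp (ham ψ x r a) - Real.exp (truncate C (ham ψ x r) a)|)
        / ∑ a, w a * Real.exp (ham ψ x r a)
      ≤ ∑ a, ∑ b, Real.exp (-C) * (w a * w b)
        * (Real.exp (2 * ham ψ x r a + (-1) * ham ψ x r b)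
          + Real.exp (0 * ham ψ x r a + (-1) * ham ψ x r b)) := fun r => by
    rw [div_eq_mul_inv]
    refine (mul_le_mul (Finset.sum_le_sum fun a _ => mul_le_mul_of_nonneg_left
      (abs_exp_sub_exp_truncate_le hC (ham ψ x r) a) (hw.nonneg a)) (inv_partition_le hw _)
      (inv_nonneg.2 (partition_pos hw _).le) (Finset.sum_nonneg fun a _ =>
        mul_nonneg (hw.nonneg a) (by positivity))).trans (le_of_eq ?_)
    rw [Finset.sum_mul_sum]
    refine Finset.sum_congr rfl fun a _ => Finset.sum_congr rfl fun b _ => ?_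
    rw [Real.exp_add, Real.exp_add, zero_mul, Real.exp_zero, neg_one_mul]
    ring
  refine (Finset.expect_le_expect fun r _ => hpt r).trans ?_
  simp only [Finset.expect_sum_comm, ← Finset.mul_expect, Finset.expect_add_distrib]
  have hb : ∀ a b, Real.exp (-C) * (w a * w b)
      * (𝔼 r, Real.exp (2 * ham ψ x r a + (-1) * ham ψ x r b)
        + 𝔼 r, Real.exp (0 * ham ψ x r a + (-1) * ham ψ x r b))
      ≤ (2 * Real.exp (5 * D - C)) * (w a * w b) := fun a b => by
    have h1 := hexp 2 (-1) (by norm_num) (by norm_num) a b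
    have h2 := hexp 0 (-1) (by norm_num) (by norm_num) a b
    have h3 : 0 ≤ Real.exp (-C) * (w a * w b) :=
      mul_nonneg (Real.exp_pos _).le (mul_nonneg (hw.nonneg a) (hw.nonneg b))
    refine (mul_le_mul_of_nonneg_left (add_le_add h1 h2) h3).trans (le_of_eq ?_)
    rw [sub_eq_add_neg, Real.exp_add]
    ring
  refine (Finset.sum_le_sum fun a _ => Finset.sum_le_sum fun b _ => hb a b).trans (le_of_eq ?_)
  simp only [← Finset.mul_sum, hw.sum_one, mul_one]

/-- Positivity for finitely many configurations with a uniformly bounded perturbation. -/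
theorem exists_bounded_perturbation {ε : ℝ} (hε : 0 < ε) :
    ∃ C : ℝ, 0 < C ∧ ∀ {N : ℕ} {S : Type} [Fintype S] (z : S → EuclideanSpace ℝ (Fin N)),
      (∀ a, ‖z a‖ = 1) → ∃ (Θ : Type) (_ : Fintype Θ) (_ : Nonempty Θ) (g : Θ → S → ℝ),
        (∀ θ a, |g θ a| ≤ C) ∧ ∀ w : S → ℝ, IsWeight w →
          𝔼 θ, gibbs w (g θ) (fun a => gibbs w (g θ)
            (neg (fun a b => inner ℝ (z a) (z b)) ε a)) ≤ ε := by
  obtain ⟨D, hD0, hD⟩ := exists_random_hamiltonian (half_pos hε)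
  -- Replacing both Gibbs averages costs `4 * 2 * exp (-16 / ε) ≤ ε / 2`; the other half of `ε` is
  -- spent on the untruncated Hamiltonian.
  set C : ℝ := 5 * D + 16 / ε with hC
  have hC0 : 0 < C := by positivity
  refine ⟨C, hC0, fun {N S} _ z hz => ?_⟩
  obtain ⟨ι, Θ, _, _, _, _, ψ, x, hx, hmain⟩ := hD z hz
  refine ⟨Θ × (ι → Bool), inferInstance, inferInstance,
    fun θ => truncate C (ham ψ (x θ.1) θ.2), fun θ a => abs_truncate_le hC0.le _ a,
    fun w hw => ?_⟩
  rw [← Finset.univ_product_univ, Finset.expect_product]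
  set R : S → S → ℝ := fun a b => inner ℝ (z a) (z b)
  have hpt : ∀ θ r, gibbs w (truncate C (ham ψ (x θ) r))
        (fun a => gibbs w (truncate C (ham ψ (x θ) r)) (neg R ε a))
      ≤ gibbs w (ham ψ (x θ) r) (fun a => gibbs w (ham ψ (x θ) r) (neg R (ε / 2) a))
        + 4 * ((∑ a, w a * |Real.exp (ham ψ (x θ) r a)
          - Real.exp (truncate C (ham ψ (x θ) r) a)|)
            / ∑ a, w a * Real.exp (ham ψ (x θ) r a)) := fun θ r => by
    set H := ham ψ (x θ) r
    set g := truncate C H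
    have hn : ∀ a b, |neg R ε a b| ≤ 1 := fun a b => by
      rw [abs_of_nonneg (neg_nonneg _ _ _ _)]; exact neg_le_one _ _ _ _
    have h1 := (abs_le.1 (abs_gibbs_sub_gibbs_le hw H g (fun a => gibbs w g (neg R ε a))
      fun a => abs_gibbs_le_of_le hw _ (hn a))).2
    set u := (∑ a, w a * |Real.exp (H a) - Real.exp (g a)|) / ∑ a, w a * Real.exp (H a)
    have h2 : gibbs w H (fun a => gibbs w g (neg R ε a))
        ≤ gibbs w H (fun a => gibbs w H (neg R (ε / 2) a) + 2 * u) :=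
      gibbs_mono hw _ fun a => by
        have h3 := (abs_le.1 (abs_gibbs_sub_gibbs_le hw H g (neg R ε a) (hn a))).2
        have h4 := gibbs_mono hw H (neg_anti R (by linarith : ε / 2 ≤ ε) a)
        linarith
    rw [gibbs_add, gibbs_const hw] at h2
    linarith
  refine (Finset.expect_le_expect fun θ _ => Finset.expect_le_expect fun r _ => hpt θ r).trans ?_
  simp only [Finset.expect_add_distrib, ← Finset.mul_expect]
  have h1 := hmain w hw
  have h2 : 𝔼 θ, 𝔼 r, (∑ a, w a * |Real.exp (ham ψ (x θ) r a)
          - Real.exp (truncate C (ham ψ (x θ) r) a)|)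
            / ∑ a, w a * Real.exp (ham ψ (x θ) r a) ≤ 2 * Real.exp (5 * D - C) :=
    Finset.expect_le Finset.univ_nonempty fun θ _ => expect_truncation_error_le hw hC0.le (hx θ)
  have h3 : Real.exp (5 * D - C) ≤ ε / 16 := by
    have e : 5 * D - C = -(16 / ε) := by rw [hC]; ring
    rw [e, Real.exp_neg, inv_le_comm₀ (Real.exp_pos _) (by positivity), inv_div]
    linarith [Real.add_one_le_exp (16 / ε)]
  linarith

end Truncation

/-! ### Discretization and choice of a realization. -/

section Discretization

/-- A compact metric space admits a measurable finite discretization of any precision. -/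
lemma exists_measurable_discretization {α : Type*} [PseudoMetricSpace α] [CompactSpace α]
    [MeasurableSpace α] [OpensMeasurableSpace α] [Nonempty α] {δ : ℝ} (hδ : 0 < δ) :
    ∃ (n : ℕ) (c : Fin n → α) (q : α → Fin n), Measurable q ∧ ∀ x, dist (c (q x)) x ≤ δ := by
  set e : ℕ → α := TopologicalSpace.denseSeq α
  obtain ⟨s, hs⟩ := isCompact_univ.elim_finite_subcover (fun i => Metric.ball (e i) δ)
    (fun i => Metric.isOpen_ball) fun x _ => by
      obtain ⟨i, hi⟩ := (TopologicalSpace.denseRange_denseSeq α).exists_dist_lt x hδ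
      exact Set.mem_iUnion.2 ⟨i, hi⟩
  set n := s.sup id
  have hlt : ∀ x, SimpleFunc.nearestPtInd e n x < n + 1 := fun x =>
    Nat.lt_succ_of_le (SimpleFunc.nearestPtInd_le e n x)
  refine ⟨n + 1, fun i => e i, fun x => ⟨SimpleFunc.nearestPtInd e n x, hlt x⟩, ?_, fun x => ?_⟩
  · refine measurable_to_countable' fun i => ?_
    convert (SimpleFunc.nearestPtInd e n).measurableSet_fiber (i : ℕ) using 1
    ext x
    simp [Fin.ext_iff]
  · obtain ⟨i, hi, hx⟩ := Set.mem_iUnion₂.1 (hs (Set.mem_univ x))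
    have h1 := SimpleFunc.edist_nearestPt_le e x (Finset.le_sup (f := id) hi)
    have h2 : dist (e (SimpleFunc.nearestPtInd e n x)) x ≤ dist (e i) x := by
      rw [edist_dist, edist_dist] at h1
      exact (ENNReal.ofReal_le_ofReal_iff dist_nonneg).1 h1
    rw [Metric.mem_ball, dist_comm] at hx
    exact h2.trans hx.le

variable {α : Type*} [MeasurableSpace α] {n : ℕ}

lemma isWeight_preimage (μ : Measure α) [IsProbabilityMeasure μ] {q : α → Fin n}
    (hq : Measurable q) : IsWeight fun a => μ.real (q ⁻¹' {a}) := by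
  refine ⟨fun a => measureReal_nonneg, ?_⟩
  have : IsProbabilityMeasure (μ.map q) := Measure.isProbabilityMeasure_map hq.aemeasurable
  have h1 : ∀ a, μ.real (q ⁻¹' {a}) = (μ.map q).real {a} := fun a =>
    (map_measureReal_apply hq (measurableSet_singleton a)).symm
  simp only [h1]
  rw [sum_measureReal_singleton]
  simp

/-- A density constant on cells gives each cell exactly its Gibbs weight, so the continuous problem
becomes the finite one. -/
lemma tilted_preimage (μ : Measure α) [IsProbabilityMeasure μ] {q : α → Fin n}
    (hq : Measurable q) (g : Fin n → ℝ) (a : Fin n) :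
    μ.tilted (fun x => g (q x)) (q ⁻¹' {a})
      = ENNReal.ofReal (μ.real (q ⁻¹' {a}) * Real.exp (g a)
          / ∑ b, μ.real (q ⁻¹' {b}) * Real.exp (g b)) := by
  have hms : MeasurableSet (q ⁻¹' {a}) := hq (measurableSet_singleton a)
  have : IsProbabilityMeasure (μ.map q) := Measure.isProbabilityMeasure_map hq.aemeasurable
  have hint : ∫ x, Real.exp (g (q x)) ∂μ = ∑ b, μ.real (q ⁻¹' {b}) * Real.exp (g b) := by
    rw [← integral_map (φ := q) (f := fun b => Real.exp (g b)) hq.aemeasurable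
      (Measurable.of_discrete).aestronglyMeasurable, integral_fintype .of_finite]
    refine Finset.sum_congr rfl fun b _ => ?_
    rw [map_measureReal_apply hq (measurableSet_singleton b), smul_eq_mul]
  rw [tilted_apply' _ _ hms, setLIntegral_congr_fun (g := fun _ => ENNReal.ofReal
    (Real.exp (g a) / ∫ x, Real.exp (g (q x)) ∂μ)) hms (fun x hx => by
      have : q x = a := hx
      simp only [this]), setLIntegral_const, hint, mul_div_assoc, mul_comm,
    ENNReal.ofReal_mul measureReal_nonneg, ofReal_measureReal]

/-- The probability of a bad pair under a tilted product measure is bounded by the Gibbs average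
over the discretized configurations. -/
lemma tilted_prod_le (μ : Measure α) [IsProbabilityMeasure μ] {q : α → Fin n}
    (hq : Measurable q) (g : Fin n → ℝ) (R : Fin n → Fin n → ℝ) (θ : ℝ) {A : Set (α × α)}
    (hA : ∀ p ∈ A, R (q p.1) (q p.2) ≤ -θ) :
    ((μ.tilted fun x => g (q x)).prod (μ.tilted fun x => g (q x))) A
      ≤ ENNReal.ofReal (gibbs (fun a => μ.real (q ⁻¹' {a})) g fun a =>
          gibbs (fun a => μ.real (q ⁻¹' {a})) g (neg R θ a)) := by
  classical
  set w : Fin n → ℝ := fun a => μ.real (q ⁻¹' {a}) with hw'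
  have hw : IsWeight w := isWeight_preimage μ hq
  have hZ := partition_pos hw g
  set ν := μ.tilted fun x => g (q x) with hν
  have hprob : IsProbabilityMeasure ν := by
    refine isProbabilityMeasure_tilted ?_
    have : Integrable (fun b => Real.exp (g b)) (μ.map q) := by
      have : IsProbabilityMeasure (μ.map q) := Measure.isProbabilityMeasure_map hq.aemeasurable
      exact .of_finite
    exact this.comp_measurable hq
  set p : Fin n → ℝ := fun a => w a * Real.exp (g a) / ∑ b, w b * Real.exp (g b) with hp
  have hp0 : ∀ a, 0 ≤ p a := fun a =>
    div_nonneg (mul_nonneg (hw.nonneg a) (Real.exp_pos _).le) hZ.le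
  have hνp : ∀ a, ν (q ⁻¹' {a}) = ENNReal.ofReal (p a) := fun a => tilted_preimage μ hq g a
  set B : Finset (Fin n × Fin n) := Finset.univ.filter fun ab => R ab.1 ab.2 ≤ -θ
  have hsub : A ⊆ ⋃ ab ∈ B, (q ⁻¹' {ab.1}) ×ˢ (q ⁻¹' {ab.2}) := fun x hx =>
    Set.mem_iUnion₂.2 ⟨(q x.1, q x.2), Finset.mem_filter.2 ⟨Finset.mem_univ _, hA x hx⟩,
      ⟨rfl, rfl⟩⟩
  refine (measure_mono hsub).trans ((measure_biUnion_finset_le B _).trans (le_of_eq ?_))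
  simp only [Measure.prod_prod, hνp, ← ENNReal.ofReal_mul (hp0 _)]
  rw [← ENNReal.ofReal_sum_of_nonneg fun ab _ => mul_nonneg (hp0 _) (hp0 _)]
  congr 1
  have e : ∀ f : Fin n → ℝ, gibbs w g f = ∑ a, p a * f a := fun f => by
    unfold gibbs
    rw [Finset.sum_div]
    exact Finset.sum_congr rfl fun a _ => by rw [hp]; ring
  simp only [e, Finset.mul_sum]
  rw [Finset.sum_filter, Fintype.sum_prod_type]
  refine Finset.sum_congr rfl fun a _ => Finset.sum_congr rfl fun b _ => ?_
  unfold neg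
  split_ifs <;> simp

/-- The lower integral is superadditive for arbitrary functions. This direction suffices, so
measurability of the bad-pair probability in `ν` is never needed. -/
lemma sum_lintegral_le {β κ : Type*} [MeasurableSpace β] (Q : Measure β) (s : Finset κ)
    (f : κ → β → ENNReal) :
    ∑ k ∈ s, ∫⁻ x, f k x ∂Q ≤ ∫⁻ x, ∑ k ∈ s, f k x ∂Q := by
  classical
  induction s using Finset.induction_on with
  | empty => simp
  | insert k s hk ih =>
    simp only [Finset.sum_insert hk]
    exact (add_le_add le_rfl ih).trans (le_lintegral_add _ _)

/-- If the average over a finite family is small everywhere, then some member of the family has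
small integral. -/
lemma exists_lintegral_le {β κ : Type*} [MeasurableSpace β] (Q : Measure β)
    [IsProbabilityMeasure Q] [Fintype κ] [Nonempty κ] (f : κ → β → ENNReal) (c : ENNReal)
    (h : ∀ x, ∑ k, f k x ≤ Fintype.card κ * c) : ∃ k, ∫⁻ x, f k x ∂Q ≤ c := by
  by_contra! hc
  have h1 := ENNReal.sum_lt_sum_of_nonempty Finset.univ_nonempty fun k (_ : k ∈ Finset.univ) => hc k
  have h2 := (sum_lintegral_le Q Finset.univ f).trans (lintegral_mono h)
  rw [Finset.sum_const, Finset.card_univ, nsmul_eq_mul] at h1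
  rw [lintegral_const, measure_univ, mul_one] at h2
  exact absurd (h1.trans_le h2) (lt_irrefl _)

end Discretization

end SpinGlass

/-! ### The theorem on the sphere. -/

theorem corollary1 :
    ∃ L : ℝ, 0 < L ∧ ∀ ε : ℝ, 0 < ε → ∃ v₀ : ℝ, 0 < v₀ ∧ ∀ v : ℝ, v₀ ≤ v →
      ∀ (N : ℕ)
        (Q : Measure (ProbabilityMeasure (Metric.sphere (0 : EuclideanSpace ℝ (Fin N)) 1))),
        IsProbabilityMeasure Q →
        ∃ g : Metric.sphere (0 : EuclideanSpace ℝ (Fin N)) 1 → ℝ,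
          Measurable g ∧
          (∀ z, |g z| ≤ L * v * Real.sqrt N) ∧
          ∫⁻ ν, (((ν : Measure (Metric.sphere (0 : EuclideanSpace ℝ (Fin N)) 1)).tilted g).prod
              ((ν : Measure (Metric.sphere (0 : EuclideanSpace ℝ (Fin N)) 1)).tilted g))
              {p | inner ℝ (p.1 : EuclideanSpace ℝ (Fin N)) (p.2 : EuclideanSpace ℝ (Fin N)) ≤ -ε}
            ∂Q ≤ ENNReal.ofReal ε := by
  -- The perturbation is bounded by a constant `C` depending on `ε` only, so `L = 1` and `v₀ = C`
  -- suffice once `√N ≥ 1`.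
  refine ⟨1, one_pos, fun ε hε => ?_⟩
  obtain ⟨C, hC0, hC⟩ := SpinGlass.exists_bounded_perturbation (half_pos hε)
  refine ⟨C, hC0, fun v hv N Q hQ => ?_⟩
  obtain ⟨ν₀⟩ : Nonempty (ProbabilityMeasure (Metric.sphere (0 : EuclideanSpace ℝ (Fin N)) 1)) :=
    nonempty_of_isProbabilityMeasure Q
  have hne : Nonempty (Metric.sphere (0 : EuclideanSpace ℝ (Fin N)) 1) :=
    nonempty_of_isProbabilityMeasure
      (ν₀ : Measure (Metric.sphere (0 : EuclideanSpace ℝ (Fin N)) 1))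
  -- The sphere is empty for `N = 0`, but `Q` being a probability provides a probability measure on
  -- it, hence a point.
  have hN : 1 ≤ Real.sqrt N := by
    rcases Nat.eq_zero_or_pos N with rfl | h
    · obtain ⟨z, hz⟩ := hne
      rw [mem_sphere_zero_iff_norm, Subsingleton.elim z 0, norm_zero] at hz
      exact absurd hz zero_ne_one
    · rw [Real.one_le_sqrt]
      exact_mod_cast h
  -- Moving two unit vectors by `ε / 4` each changes their overlap by at most `ε / 2`, so a pair
  -- below `-ε` has centres below `-(ε / 2)`.
  obtain ⟨n, c, q, hq, hdist⟩ := SpinGlass.exists_measurable_discretization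
    (α := Metric.sphere (0 : EuclideanSpace ℝ (Fin N)) 1) (by positivity : 0 < ε / 4)
  have hnorm : ∀ z : Metric.sphere (0 : EuclideanSpace ℝ (Fin N)) 1,
      ‖(z : EuclideanSpace ℝ (Fin N))‖ = 1 := fun z => mem_sphere_zero_iff_norm.1 z.2
  obtain ⟨Θ, _, _, G, hG, hGibbs⟩ := hC (fun a => (c a : EuclideanSpace ℝ (Fin N)))
    fun a => hnorm _
  have hbad : ∀ p ∈ {p : Metric.sphere (0 : EuclideanSpace ℝ (Fin N)) 1
        × Metric.sphere (0 : EuclideanSpace ℝ (Fin N)) 1 |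
        inner ℝ (p.1 : EuclideanSpace ℝ (Fin N)) (p.2 : EuclideanSpace ℝ (Fin N)) ≤ -ε},
      inner ℝ (c (q p.1) : EuclideanSpace ℝ (Fin N)) (c (q p.2) : EuclideanSpace ℝ (Fin N))
        ≤ -(ε / 2) := by
    rintro ⟨x, y⟩ hp
    have hp' : inner ℝ (x : EuclideanSpace ℝ (Fin N)) (y : EuclideanSpace ℝ (Fin N)) ≤ -ε := hp
    have hx : ‖(c (q x) : EuclideanSpace ℝ (Fin N)) - x‖ ≤ ε / 4 := by
      rw [← dist_eq_norm]; exact hdist x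
    have hy : ‖(c (q y) : EuclideanSpace ℝ (Fin N)) - y‖ ≤ ε / 4 := by
      rw [← dist_eq_norm]; exact hdist y
    have e : inner ℝ (c (q x) : EuclideanSpace ℝ (Fin N)) (c (q y) : EuclideanSpace ℝ (Fin N))
        = inner ℝ (x : EuclideanSpace ℝ (Fin N)) (y : EuclideanSpace ℝ (Fin N))
          + inner ℝ ((c (q x) : EuclideanSpace ℝ (Fin N)) - x)
            (c (q y) : EuclideanSpace ℝ (Fin N))
          + inner ℝ (x : EuclideanSpace ℝ (Fin N))
            ((c (q y) : EuclideanSpace ℝ (Fin N)) - y) := by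
      rw [inner_sub_left, inner_sub_right]
      ring
    have h1 := real_inner_le_norm ((c (q x) : EuclideanSpace ℝ (Fin N)) - x)
      (c (q y) : EuclideanSpace ℝ (Fin N))
    have h2 := real_inner_le_norm (x : EuclideanSpace ℝ (Fin N))
      ((c (q y) : EuclideanSpace ℝ (Fin N)) - y)
    rw [hnorm, mul_one] at h1
    rw [hnorm, one_mul] at h2
    change inner ℝ (c (q x) : EuclideanSpace ℝ (Fin N)) (c (q y) : EuclideanSpace ℝ (Fin N)) ≤ _
    linarith
  -- The family `G` was fixed before any `ν`, and its average is small for each `ν`; hence one index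
  -- `θ` works for `Q`.
  obtain ⟨θ, hθ⟩ := SpinGlass.exists_lintegral_le Q (fun (θ : Θ)
    (ν : ProbabilityMeasure (Metric.sphere (0 : EuclideanSpace ℝ (Fin N)) 1)) =>
      (((ν : Measure (Metric.sphere (0 : EuclideanSpace ℝ (Fin N)) 1)).tilted
          fun z => G θ (q z)).prod
        ((ν : Measure (Metric.sphere (0 : EuclideanSpace ℝ (Fin N)) 1)).tilted
          fun z => G θ (q z)))
        {p | inner ℝ (p.1 : EuclideanSpace ℝ (Fin N)) (p.2 : EuclideanSpace ℝ (Fin N)) ≤ -ε})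
    (ENNReal.ofReal ε) fun ν => by
      set μ := (ν : Measure (Metric.sphere (0 : EuclideanSpace ℝ (Fin N)) 1))
      have hw := SpinGlass.isWeight_preimage μ hq
      refine (Finset.sum_le_sum fun θ _ => SpinGlass.tilted_prod_le μ hq (G θ)
        (fun a b => inner ℝ (c a : EuclideanSpace ℝ (Fin N)) (c b : EuclideanSpace ℝ (Fin N)))
        (ε / 2) hbad).trans ?_
      rw [← ENNReal.ofReal_sum_of_nonneg fun θ _ => SpinGlass.gibbs_nonneg hw (G θ) fun a =>
          SpinGlass.gibbs_nonneg hw (G θ) fun b => SpinGlass.neg_nonneg _ _ a b,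
        ← ENNReal.ofReal_natCast,
        ← ENNReal.ofReal_mul (Nat.cast_nonneg _)]
      refine ENNReal.ofReal_le_ofReal ?_
      have h1 := hGibbs _ hw
      rw [Fintype.expect_eq_sum_div_card, div_le_iff₀ (by exact_mod_cast Fintype.card_pos)] at h1
      have h2 : (0 : ℝ) ≤ Fintype.card Θ := Nat.cast_nonneg _
      nlinarith
  refine ⟨fun z => G θ (q z), (Measurable.of_discrete (f := G θ)).comp hq, fun z => ?_, hθ⟩
  have h1 := hG θ (q z)
  have hv0 : 0 ≤ v := hC0.le.trans hv
  nlinarith
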